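/- Let $U,V$ be real separable Hilbert spaces; identify $U'=U$ and $V''=V$ (but not $V'$ with $V$), and write $\langle\cdot,\cdot\rangle$ for the duality between $V'$ and $V$. Let $A:D(A)\subset V'\to V'$ generate a $C_0$-semigroup $(e^{\tau A})_{\tau\ge0}$ on $V'$ with $|e^{\tau A}x|_{V'}\le e^{\omega\tau}|x|_{V'}$ for all $\tau\ge0$, $x\in V'$, where $\omega\in\mathbb R$, and let $A_1^*:D(A_1^*)\subset V\to V$ be its adjoint in the duality $\langle\cdot,\cdot\rangle$. Let $B\in\mathcal L(U,V')$ with adjoint $B^*:V\to U$. Let $g_0:V'\to\mathbb R$ be convex and Fréchet differentiable with Lipschitz derivative $g_0':V'\to V$. Let $h_0:U\to\mathbb R$ be convex and lower semicontinuous, with $\partial h_0(u_1)\cap\partial h_0(u_2)=\emptyset$ for $u_1\ne u_2$, and with $h_0(u)\ge a|u|_U^p+b$ for all $u\in U$, for some $a>0$, $b\in\mathbb R$. Assume that the convex conjugate $h_0^*$ satisfies $h_0^*(0)=0$ and is (convex and) Fréchet differentiable with Lipschitz derivative. Assume $p\ge2$ and $\lambda>\max(2\omega,\omega)$. For $t\ge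 0$ and $x\in V'$, and for a control $u$ in $L^p_\lambda(t,\infty;U)=\{u:\ \tau\mapsto e^{-\lambda\tau/p}u(\tau)\in L^p(t,\infty;U)\}$, let $y(\tau)=e^{(\tau-t)A}x+\int_t^\tau e^{(\tau-\sigma)A}Bu(\sigma)\,d\sigma$ and $$J(t,x,u)=\int_t^\infty e^{-\lambda\tau}\,[g_0(y(\tau))+h_0(u(\tau))]\,d\tau .$$ A control in $L^p_\lambda(t,\infty;U)$ is optimal at $(t,x)$ if it minimizes $J(t,x,\cdot)$ over $L^p_\lambda(t,\infty;U)$. Put $Z_0(x)=\inf_{u\in L^p_\lambda(0,\infty;U)}J(0,x,u)$ and $\partial Z_0(x)=\{v\in V:\ Z_0(y)\ge Z_0(x)+\langle y-x,v\rangle\ \ \forall y\in V'\}$ (at points $x$ where $Z_0(x)$ is finite). An MP-equilibrium point is a triple $(x,\pi,u)\in D(A)\times D(A_1^*)\times U$ with $Ax+Bu=0$, $(\lambda-A_1^*)\pi-g_0'(x)=0$ and $u=(h_0^*)'(-B^*\pi)$. A CLE-equilibrium point is an $x\in D(A)$ such that $Ax+B(h_0^*)'(-B^*v)=0$ for some $v\in\partial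 Z_0(x)$. Then $\lambda$ is in the resolvent set of $A_1^*$, and: (i) If $(\bar x,\bar\pi,\bar u)$ is an MP-equilibrium point, then $A\bar x+B(h_0^*)'\big(-B^*(\lambda-A_1^*)^{-1}g_0'(\bar x)\big)=0$. If moreover $\lambda>0$, then the constant control $\bar u$ is optimal at $(0,\bar x)$, $\bar x$ is a CLE-equilibrium point, and $(\lambda-A_1^*)^{-1}g_0'(\bar x)\in\partial Z_0(\bar x)$. (ii) Suppose that $\lambda>0$, that either $p>2$, or $p=2$ and $\omega<0$, and that $Z_0$ is (finite and) Fréchet differentiable on $V'$. If $\hat x$ is a CLE-equilibrium point, and $\hat\pi:=(\lambda-A_1^*)^{-1}g_0'(\hat x)$ and $\hat u:=(h_0^*)'(-B^*\hat\pi)$, then $(\hat x,\hat\pi,\hat u)$ is an MP-equilibrium point, the constant control $\hat u$ is optimal at $(0,\hat x)$, and $Z_0'(\hat x)=\hat\pi$. -/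

import Mathlib

open Set Filter Topology MeasureTheory
open scoped ENNReal RealInnerProductSpace

noncomputable section

/-! ## Strongly continuous semigroups, generators, resolvents -/

/-- A strongly continuous semigroup `(S τ)_{τ ≥ 0}` of bounded operators on `X`
(the values at negative times are irrelevant). -/
structure C0Semigroup (X : Type*) [NormedAddCommGroup X] [NormedSpace ℝ X] where
  toFun : ℝ → X →L[ℝ] X
  map_zero' : toFun 0 = ContinuousLinearMap.id ℝ X
  map_add' : ∀ s t : ℝ, 0 ≤ s → 0 ≤ t → toFun (s + t) = (toFun s).comp (toFun t)
  strongly_continuous' : ∀ x : X, Tendsto (fun t : ℝ => toFun t x) (𝓝[>] 0) (𝓝 x)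

instance {X : Type*} [NormedAddCommGroup X] [NormedSpace ℝ X] :
    CoeFun (C0Semigroup X) (fun _ => ℝ → X →L[ℝ] X) := ⟨C0Semigroup.toFun⟩

/-- The operator `A : D(A) ⊆ X → X` is the infinitesimal generator of the semigroup `S`:
`x ∈ D(A)` and `A x = y` iff `(S h x - x) / h → y` as `h → 0+`. -/
def IsInfinitesimalGenerator {X : Type*} [NormedAddCommGroup X] [NormedSpace ℝ X]
    (S : C0Semigroup X) (A : X →ₗ.[ℝ] X) : Prop :=
  ∀ x y : X, (x, y) ∈ A.graph ↔
    Tendsto (fun h : ℝ => h⁻¹ • (S h x - x)) (𝓝[>] 0) (𝓝 y)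

/-- `R` is the bounded everywhere defined inverse `(lam - T)⁻¹` of `lam - T : D(T) → X`. -/
def IsResolventOperator {X : Type*} [NormedAddCommGroup X] [NormedSpace ℝ X]
    (T : X →ₗ.[ℝ] X) (lam : ℝ) (R : X →L[ℝ] X) : Prop :=
  (∀ v : X, ∃ h : R v ∈ T.domain, lam • R v - T ⟨R v, h⟩ = v) ∧
    ∀ v : T.domain, R (lam • (v : X) - T v) = v

/-- `lam` belongs to the resolvent set `ρ(T)`. -/
def InResolventSet {X : Type*} [NormedAddCommGroup X] [NormedSpace ℝ X]
    (T : X →ₗ.[ℝ] X) (lam : ℝ) : Prop :=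
  ∃ R : X →L[ℝ] X, IsResolventOperator T lam R

open Classical in
/-- The resolvent operator `(lam - T)⁻¹`, meaningful when `lam ∈ ρ(T)`. -/
def resolventOp {X : Type*} [NormedAddCommGroup X] [NormedSpace ℝ X]
    (T : X →ₗ.[ℝ] X) (lam : ℝ) : X →L[ℝ] X :=
  if h : InResolventSet T lam then h.choose else 0

/-! ## The duality between `V` and `V'` -/

/-- The graph of the adjoint, in the duality between `V` and `V'`, of an operator `A` on `V'`:
all pairs `(v, w)` with `⟨A x, v⟩ = ⟨x, w⟩` for every `x ∈ D(A)`. -/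
def dualityAdjointGraph {V : Type*} [NormedAddCommGroup V] [InnerProductSpace ℝ V]
    (A : StrongDual ℝ V →ₗ.[ℝ] StrongDual ℝ V) : Submodule ℝ (V × V) where
  carrier := {q | ∀ x : A.domain, (A x) q.1 = (x : StrongDual ℝ V) q.2}
  add_mem' := by
    intro a b ha hb x
    simp only [Set.mem_ofPred_eq] at ha hb
    simp [ha x, hb x]
  zero_mem' := by
    intro x
    simp
  smul_mem' := by
    intro c a ha x
    simp only [Set.mem_ofPred_eq] at ha
    simp [ha x]

/-- The adjoint `A₁* : D(A₁*) ⊆ V → V` of the operator `A : D(A) ⊆ V' → V'` with respect to the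
duality between `V` and `V'` (for densely defined `A`, for instance a generator). -/
def dualityAdjoint {V : Type*} [NormedAddCommGroup V] [InnerProductSpace ℝ V]
    (A : StrongDual ℝ V →ₗ.[ℝ] StrongDual ℝ V) : V →ₗ.[ℝ] V :=
  (dualityAdjointGraph A).toLinearPMap

theorem dualityAdjoint_graph {V : Type*} [NormedAddCommGroup V] [InnerProductSpace ℝ V]
    (A : StrongDual ℝ V →ₗ.[ℝ] StrongDual ℝ V)
    (hA : Dense (A.domain : Set (StrongDual ℝ V))) :
    (dualityAdjoint A).graph = dualityAdjointGraph A := by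
  refine Submodule.toLinearPMap_graph_eq _ ?_
  rintro ⟨v, w⟩ hq (hv : v = 0)
  have h0 : ∀ x : StrongDual ℝ V, x w = 0 := by
    have hc : Continuous fun x : StrongDual ℝ V => x w :=
      (ContinuousLinearMap.apply ℝ ℝ w).continuous
    have heq : (fun x : StrongDual ℝ V => x w) = fun _ => 0 := by
      refine Continuous.ext_on hA hc continuous_const ?_
      intro x hx
      have := hq ⟨x, hx⟩
      simp only [hv, _root_.map_zero] at this
      exact this.symm
    exact fun x => congrFun heq x
  have h1 := h0 (innerSL ℝ w)
  simpa using h1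

/-- The canonical identification `V'' = V` (reflexivity of the Hilbert space `V`). -/
def bidualToPrimal {V : Type*} [NormedAddCommGroup V] [InnerProductSpace ℝ V] [CompleteSpace V]
    (L : StrongDual ℝ (StrongDual ℝ V)) : V :=
  (InnerProductSpace.toDual ℝ V).symm
    (LinearMap.mkContinuous
      { toFun := fun w => L (innerSL ℝ w)
        map_add' := by intro a b; simp
        map_smul' := by intro c a; simp }
      ‖L‖ (by
        intro w
        simpa using L.le_opNorm (innerSL ℝ w)))

theorem apply_bidualToPrimal {V : Type*} [NormedAddCommGroup V] [InnerProductSpace ℝ V]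
    [CompleteSpace V] (L : StrongDual ℝ (StrongDual ℝ V)) (x : StrongDual ℝ V) :
    x (bidualToPrimal L) = L x := by
  obtain ⟨w, rfl⟩ := (InnerProductSpace.toDual ℝ V).surjective x
  rw [InnerProductSpace.toDual_apply_apply, real_inner_comm, bidualToPrimal,
    InnerProductSpace.toDual_symm_apply]
  rfl

/-- The Fréchet derivative `f'(x) ∈ V'' = V` of a function `f : V' → ℝ`. -/
def dualGradient {V : Type*} [NormedAddCommGroup V] [InnerProductSpace ℝ V] [CompleteSpace V]
    (f : StrongDual ℝ V → ℝ) (x : StrongDual ℝ V) : V :=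
  bidualToPrimal (fderiv ℝ f x)

/-- The adjoint `B* : V → U` of `B ∈ L(U, V')`, where `U' = U`: `⟨B u, v⟩ = (B* v | u)_U`. -/
def controlAdjoint {U V : Type*} [NormedAddCommGroup U] [InnerProductSpace ℝ U] [CompleteSpace U]
    [NormedAddCommGroup V] [InnerProductSpace ℝ V]
    (B : U →L[ℝ] StrongDual ℝ V) (v : V) : U :=
  (InnerProductSpace.toDual ℝ U).symm (B.flip v)

theorem inner_controlAdjoint {U V : Type*} [NormedAddCommGroup U] [InnerProductSpace ℝ U]
    [CompleteSpace U] [NormedAddCommGroup V] [InnerProductSpace ℝ V]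
    (B : U →L[ℝ] StrongDual ℝ V) (v : V) (u : U) : ⟪controlAdjoint B v, u⟫ = B u v := by
  simp [controlAdjoint]

/-! ## Convex analysis -/

/-- The class `Σ₀(X)`: convex, Fréchet differentiable functions with Lipschitz derivative. -/
def IsSigmaZero {X : Type*} [NormedAddCommGroup X] [NormedSpace ℝ X] (f : X → ℝ) : Prop :=
  ConvexOn ℝ univ f ∧ Differentiable ℝ f ∧ ∃ K : NNReal, LipschitzWith K (fderiv ℝ f)

/-- The subdifferential `∂h(u)` of a real function on the Hilbert space `U`. -/
def subdiff {U : Type*} [NormedAddCommGroup U] [InnerProductSpace ℝ U]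
    (h : U → ℝ) (u : U) : Set U :=
  {w | ∀ v : U, ⟪w, v - u⟫ ≤ h v - h u}

/-- Injectivity of the multivalued map `u ↦ ∂h(u)`. -/
def InjectiveSubdiff {U : Type*} [NormedAddCommGroup U] [InnerProductSpace ℝ U]
    (h : U → ℝ) : Prop :=
  ∀ u₁ u₂ : U, u₁ ≠ u₂ → subdiff h u₁ ∩ subdiff h u₂ = ∅

/-- The convex conjugate `h*(w) = sup_u ((w | u) - h(u))` (a finite supremum when `h` has
superlinear growth). -/
def convexConj {U : Type*} [NormedAddCommGroup U] [InnerProductSpace ℝ U]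
    (h : U → ℝ) (w : U) : ℝ :=
  ⨆ u : U, (⟪w, u⟫ - h u)

/-- The subdifferential `∂Z(x) ⊆ V` of an extended real function on `V'`, at a point `x` where it
is finite; it is empty at the other points. -/
def dualSubdiff {V : Type*} [NormedAddCommGroup V] [InnerProductSpace ℝ V]
    (Z : StrongDual ℝ V → EReal) (x : StrongDual ℝ V) : Set V :=
  {v | Z x ≠ ⊥ ∧ Z x ≠ ⊤ ∧ ∀ y : StrongDual ℝ V, Z x + (((y - x) v : ℝ) : EReal) ≤ Z y}

/-! ## The control problem -/

/-- The standing assumptions on the data of the control problem with state space `V'`. -/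
structure StandingAssumptions {U V : Type*}
    [NormedAddCommGroup U] [InnerProductSpace ℝ U] [CompleteSpace U]
    [NormedAddCommGroup V] [InnerProductSpace ℝ V] [CompleteSpace V]
    (S : C0Semigroup (StrongDual ℝ V)) (A : StrongDual ℝ V →ₗ.[ℝ] StrongDual ℝ V)
    (g₀ : StrongDual ℝ V → ℝ) (h₀ : U → ℝ) (p lam ω : ℝ) : Prop where
  generator : IsInfinitesimalGenerator S A
  growth : ∀ τ : ℝ, 0 ≤ τ → ∀ x : StrongDual ℝ V, ‖S τ x‖ ≤ Real.exp (ω * τ) * ‖x‖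
  g₀_sigma : IsSigmaZero g₀
  h₀_convex : ConvexOn ℝ univ h₀
  h₀_lsc : LowerSemicontinuous h₀
  h₀_inj : InjectiveSubdiff h₀
  conj_zero : convexConj h₀ 0 = 0
  conj_sigma : IsSigmaZero (convexConj h₀)
  coercive : 1 < p ∧ ∃ a b : ℝ, 0 < a ∧ ∀ u : U, a * ‖u‖ ^ p + b ≤ h₀ u
  discount : ω < lam

/-- Admissible controls: `u ∈ L^p_lam(t, +∞; U)`, i.e. `τ ↦ e^{-lam τ / p} u(τ)` is in
`L^p(t, +∞; U)`. -/
def IsAdmissible {U : Type*} [NormedAddCommGroup U] [InnerProductSpace ℝ U]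
    (p lam t : ℝ) (u : ℝ → U) : Prop :=
  MemLp (fun τ : ℝ => Real.exp (-(lam * τ) / p) • u τ) (ENNReal.ofReal p)
    (volume.restrict (Ioi t))

/-- The mild solution of `y' = A y + B u`, `y(t) = x`. -/
def trajectory {U V : Type*} [NormedAddCommGroup U] [InnerProductSpace ℝ U]
    [NormedAddCommGroup V] [InnerProductSpace ℝ V]
    (S : C0Semigroup (StrongDual ℝ V)) (B : U →L[ℝ] StrongDual ℝ V)
    (t : ℝ) (x : StrongDual ℝ V) (u : ℝ → U) (τ : ℝ) : StrongDual ℝ V :=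
  S (τ - t) x + ∫ σ in t..τ, S (τ - σ) (B (u σ))

/-- The integral over `(t, +∞)` of a real function, with values in `[-∞, +∞]`: the integral of the
positive part minus that of the negative part. -/
def extendedIntegral (t : ℝ) (f : ℝ → ℝ) : EReal :=
  ((∫⁻ τ in Ioi t, ENNReal.ofReal (f τ) : ℝ≥0∞) : EReal) -
    ((∫⁻ τ in Ioi t, ENNReal.ofReal (-f τ) : ℝ≥0∞) : EReal)

/-- The cost `J(t, x, u) = ∫_t^∞ e^{-lam τ} [g₀(y(τ)) + h₀(u(τ))] dτ`. For `0 < lam` and admissible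
`u` the negative part of the integrand is integrable, so that the value lies in `(-∞, +∞]`. -/
def cost {U V : Type*} [NormedAddCommGroup U] [InnerProductSpace ℝ U]
    [NormedAddCommGroup V] [InnerProductSpace ℝ V]
    (S : C0Semigroup (StrongDual ℝ V)) (B : U →L[ℝ] StrongDual ℝ V)
    (g₀ : StrongDual ℝ V → ℝ) (h₀ : U → ℝ) (lam t : ℝ) (x : StrongDual ℝ V) (u : ℝ → U) : EReal :=
  extendedIntegral t fun τ =>
    Real.exp (-(lam * τ)) * (g₀ (trajectory S B t x u τ) + h₀ (u τ))

/-- The control `u` is optimal at `(t, x)`. -/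
def IsOptimalControl {U V : Type*} [NormedAddCommGroup U] [InnerProductSpace ℝ U]
    [NormedAddCommGroup V] [InnerProductSpace ℝ V]
    (S : C0Semigroup (StrongDual ℝ V)) (B : U →L[ℝ] StrongDual ℝ V)
    (g₀ : StrongDual ℝ V → ℝ) (h₀ : U → ℝ) (p lam t : ℝ) (x : StrongDual ℝ V) (u : ℝ → U) : Prop :=
  IsAdmissible p lam t u ∧
    ∀ v : ℝ → U, IsAdmissible p lam t v →
      cost S B g₀ h₀ lam t x u ≤ cost S B g₀ h₀ lam t x v

/-- The value function `Z(t, x)`, the infimum of `J(t, x, u)` over the admissible controls. -/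
def valueFunction {U V : Type*} [NormedAddCommGroup U] [InnerProductSpace ℝ U]
    [NormedAddCommGroup V] [InnerProductSpace ℝ V]
    (S : C0Semigroup (StrongDual ℝ V)) (B : U →L[ℝ] StrongDual ℝ V)
    (g₀ : StrongDual ℝ V → ℝ) (h₀ : U → ℝ) (p lam t : ℝ) (x : StrongDual ℝ V) : EReal :=
  ⨅ u : {u : ℝ → U // IsAdmissible p lam t u}, cost S B g₀ h₀ lam t x u

/-- `Z₀(x) = Z(0, x)`. -/
def valueZero {U V : Type*} [NormedAddCommGroup U] [InnerProductSpace ℝ U]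
    [NormedAddCommGroup V] [InnerProductSpace ℝ V]
    (S : C0Semigroup (StrongDual ℝ V)) (B : U →L[ℝ] StrongDual ℝ V)
    (g₀ : StrongDual ℝ V → ℝ) (h₀ : U → ℝ) (p lam : ℝ) (x : StrongDual ℝ V) : EReal :=
  valueFunction S B g₀ h₀ p lam 0 x

/-! ## Equilibrium points -/

/-- The feedback `v ↦ (h₀*)'(-B* v)` from `V` to `U`. -/
def feedback {U V : Type*} [NormedAddCommGroup U] [InnerProductSpace ℝ U] [CompleteSpace U]
    [NormedAddCommGroup V] [InnerProductSpace ℝ V]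
    (B : U →L[ℝ] StrongDual ℝ V) (h₀ : U → ℝ) (v : V) : U :=
  gradient (convexConj h₀) (-controlAdjoint B v)

/-- `(x, π, u) ∈ D(A) × D(A₁*) × U` is an MP-equilibrium point: `A x + B u = 0`,
`(lam - A₁*) π - g₀'(x) = 0`, `u = (h₀*)'(-B* π)`. -/
def IsMPEquilibrium {U V : Type*} [NormedAddCommGroup U] [InnerProductSpace ℝ U] [CompleteSpace U]
    [NormedAddCommGroup V] [InnerProductSpace ℝ V] [CompleteSpace V]
    (A : StrongDual ℝ V →ₗ.[ℝ] StrongDual ℝ V) (B : U →L[ℝ] StrongDual ℝ V)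
    (g₀ : StrongDual ℝ V → ℝ) (h₀ : U → ℝ) (lam : ℝ)
    (x : StrongDual ℝ V) (π : V) (u : U) : Prop :=
  (∃ hx : x ∈ A.domain, A ⟨x, hx⟩ + B u = 0) ∧
    (∃ hπ : π ∈ (dualityAdjoint A).domain,
      lam • π - dualityAdjoint A ⟨π, hπ⟩ - dualGradient g₀ x = 0) ∧
    u = feedback B h₀ π

/-- `x` is a CLE-equilibrium point: `x ∈ D(A)` and `A x + B (h₀*)'(-B* ∂Z₀(x)) ∋ 0`. -/
def IsCLEEquilibrium {U V : Type*} [NormedAddCommGroup U] [InnerProductSpace ℝ U] [CompleteSpace U]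
    [NormedAddCommGroup V] [InnerProductSpace ℝ V]
    (S : C0Semigroup (StrongDual ℝ V)) (A : StrongDual ℝ V →ₗ.[ℝ] StrongDual ℝ V)
    (B : U →L[ℝ] StrongDual ℝ V) (g₀ : StrongDual ℝ V → ℝ) (h₀ : U → ℝ) (p lam : ℝ)
    (x : StrongDual ℝ V) : Prop :=
  ∃ hx : x ∈ A.domain, ∃ v ∈ dualSubdiff (valueZero S B g₀ h₀ p lam) x,
    A ⟨x, hx⟩ + B (feedback B h₀ v) = 0

end

/-! Write R(m) for the Laplace transform of the semigroup. For m > ω it inverts m - A on V', and its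
transpose on V inverts m - A₁*. An MP costate is therefore π = R(λ)* g₀'(x).

Sufficiency is a convexity argument. At a stationary pair (x₀, u₀) with u₀ = (h₀*)'(-B*π), the
gradient inequality for g₀ and the relation -B*π ∈ ∂h₀(u₀) bound the running cost below by an affine
function of the trajectory and the control. The discounted integral of y - x₀ is R(λ)(x - x₀ + Bw),
where w is the discounted integral of u - u₀. Pairing it with g₀'(x₀) produces ⟨Bw, π⟩, which
cancels the control term. What remains is a lower bound for every cost, affine in x with slope π and
attained at x₀ by the constant control (`le_cost`, `cost_const_stationary`). This gives optimality
and π ∈ ∂Z₀(x₀) together.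

For the converse, let v ∈ ∂Z₀(x₀) realize a CLE. The point is to prove v = π. Testing Z₀ at x₀ + ξ
with the constant control gives the upper bound λ⁻¹(g₀ + h₀) + ⟨ξ, π⟩ + O(|ξ|²), the remainder being
finite because λ > 2ω (`cost_const_le`). The subgradient gives the lower bound Z₀(x₀) + ⟨ξ, v⟩. If
g₀(x₀) + h₀(u₀) ≤ λ Z₀(x₀), comparing first orders forces v = π.

That inequality (`running_cost_le_mul_value`) is formally the HJB equation at x₀, but v need not lie
in D(A₁*), so dynamic programming cannot simply be differentiated at time 0. It is instead averaged
against (m - λ)e^{-(m-λ)T} dT, which replaces A₁* by its resolvents. The error is ⟨Bw, e⟩ with e =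
R(m)*g₀'(x₀) + (m - λ)R(m)*v - v, which tends to 0 as m → ∞. The superlinear growth of h₀ absorbs it
uniformly over all controls. -/

noncomputable section

/-! ## Exponentially bounded semigroups -/

section Semigroup

variable {X : Type*} [NormedAddCommGroup X] [NormedSpace ℝ X]

/-- The growth bound `‖S τ x‖ ≤ e^{ω τ} ‖x‖` for `τ ≥ 0`. -/
def C0Semigroup.HasGrowth (S : C0Semigroup X) (ω : ℝ) : Prop :=
  ∀ τ : ℝ, 0 ≤ τ → ∀ x : X, ‖S τ x‖ ≤ Real.exp (ω * τ) * ‖x‖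

namespace C0Semigroup

variable {S : C0Semigroup X} {ω m : ℝ}

theorem apply_zero (S : C0Semigroup X) (x : X) : S 0 x = x := by
  have := S.map_zero'
  rw [this]; rfl

theorem apply_add (S : C0Semigroup X) {s t : ℝ} (hs : 0 ≤ s) (ht : 0 ≤ t) (x : X) :
    S (s + t) x = S s (S t x) := by
  have := S.map_add' s t hs ht
  rw [this]; rfl

theorem norm_le_exp_abs (hS : S.HasGrowth ω) {τ T : ℝ} (hτ : 0 ≤ τ) (hT : τ ≤ T) (x : X) :
    ‖S τ x‖ ≤ Real.exp (|ω| * T) * ‖x‖ := by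
  refine (hS τ hτ x).trans ?_
  gcongr
  exact le_abs_self ω

/-- The increment between two times is the increment starting at 0, transported by the semigroup at
the earlier time; strong continuity at 0 thus spreads to all times. -/
theorem norm_sub_le (hS : S.HasGrowth ω) {s t T : ℝ} (hs : 0 ≤ s) (ht : 0 ≤ t) (hsT : s ≤ T)
    (htT : t ≤ T) (x : X) : ‖S t x - S s x‖ ≤ Real.exp (|ω| * T) * ‖S |t - s| x - x‖ := by
  wlog h : s ≤ t generalizing s t
  · rw [norm_sub_rev, abs_sub_comm]
    exact this ht hs htT hsT (le_of_not_ge h)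
  · have : S t x = S s (S (t - s) x) := by
      rw [← apply_add S hs (sub_nonneg.2 h)]; congr 2; ring
    rw [this, abs_of_nonneg (sub_nonneg.2 h), ← map_sub]
    exact norm_le_exp_abs hS hs hsT _

theorem tendsto_abs (S : C0Semigroup X) (x : X) :
    Tendsto (fun r : ℝ => S |r| x) (𝓝 0) (𝓝 x) := by
  have h1 : Tendsto (fun r : ℝ => S r x) (𝓝[≥] 0) (𝓝 x) := by
    rw [← Ioi_insert, nhdsWithin_insert, tendsto_sup]
    refine ⟨?_, S.strongly_continuous' x⟩
    rw [tendsto_pure_left]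
    intro s hs
    rw [apply_zero]
    exact mem_of_mem_nhds hs
  refine h1.comp (tendsto_nhdsWithin_iff.2 ⟨?_, Eventually.of_forall fun r => abs_nonneg r⟩)
  simpa using (continuous_abs (G := ℝ)).tendsto 0

/-- The action `(t, x) ↦ S t x`, extended by `S 0` to negative times, is jointly continuous. -/
theorem continuous_max (hS : S.HasGrowth ω) :
    Continuous fun z : ℝ × X => S (max z.1 0) z.2 := by
  rw [continuous_iff_continuousAt]
  rintro ⟨s, y⟩
  rw [ContinuousAt, tendsto_iff_norm_sub_tendsto_zero]
  set T := max s 0 + 1 with hT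
  have hr : Tendsto (fun z : ℝ × X => S |max z.1 0 - max s 0| y) (𝓝 (s, y)) (𝓝 y) := by
    refine (tendsto_abs S y).comp ?_
    have : Continuous fun z : ℝ × X => max z.1 0 - max s 0 := by fun_prop
    simpa using this.tendsto (s, y)
  have hx : Tendsto (fun z : ℝ × X => z.2) (𝓝 (s, y)) (𝓝 y) := continuous_snd.tendsto (s, y)
  have hb : Tendsto (fun z : ℝ × X => Real.exp (|ω| * T) * ‖z.2 - y‖ +
      Real.exp (|ω| * T) * ‖S |max z.1 0 - max s 0| y - y‖) (𝓝 (s, y)) (𝓝 0) := by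
    have := ((tendsto_iff_norm_sub_tendsto_zero.1 hx).const_mul (Real.exp (|ω| * T))).add
      ((tendsto_iff_norm_sub_tendsto_zero.1 hr).const_mul (Real.exp (|ω| * T)))
    simpa using this
  refine squeeze_zero' (Eventually.of_forall fun z => norm_nonneg _) ?_ hb
  have hlt : ∀ᶠ z : ℝ × X in 𝓝 (s, y), max z.1 0 < T := by
    have : Continuous fun z : ℝ × X => max z.1 0 := by fun_prop
    exact this.continuousAt.eventually_lt_const (by simp [hT])
  filter_upwards [hlt] with z hz
  have : S (max z.1 0) z.2 - S (max s 0) y =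
      S (max z.1 0) (z.2 - y) + (S (max z.1 0) y - S (max s 0) y) := by
    rw [map_sub]; abel
  rw [this]
  refine (norm_add_le _ _).trans (add_le_add ?_ ?_)
  · exact norm_le_exp_abs hS (le_max_right _ _) hz.le _
  · exact norm_sub_le hS (le_max_right _ _) (le_max_right _ _) (by simp [hT]) hz.le _

theorem continuousOn_apply (hS : S.HasGrowth ω) (x : X) : ContinuousOn (fun τ => S τ x) (Ici 0) := by
  have h : Continuous fun τ : ℝ => S (max τ 0) x :=
    (continuous_max hS).comp (Continuous.prodMk_left x)
  exact h.continuousOn.congr fun τ hτ => by simp only [max_eq_left (mem_Ici.1 hτ)]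

/-! ### The Laplace transform -/

theorem norm_laplace_integrand_le (hS : S.HasGrowth ω) {τ : ℝ} (hτ : 0 ≤ τ) (x : X) :
    ‖Real.exp (-(m * τ)) • S τ x‖ ≤ Real.exp (-(m - ω) * τ) * ‖x‖ := by
  rw [norm_smul, Real.norm_eq_abs, Real.abs_exp]
  calc _ ≤ Real.exp (-(m * τ)) * (Real.exp (ω * τ) * ‖x‖) := by gcongr; exact hS τ hτ x
    _ = _ := by rw [← mul_assoc, ← Real.exp_add]; ring_nf

theorem integrableOn_exp_neg_mul {κ : ℝ} (hκ : 0 < κ) :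
    IntegrableOn (fun τ : ℝ => Real.exp (-κ * τ)) (Ioi 0) :=
  integrableOn_exp_mul_Ioi (by linarith) 0

theorem integral_exp_neg_mul {κ : ℝ} (hκ : 0 < κ) :
    ∫ τ in Ioi (0 : ℝ), Real.exp (-κ * τ) = κ⁻¹ := by
  rw [integral_exp_mul_Ioi (by linarith)]
  simp

theorem laplace_integrable (hS : S.HasGrowth ω) (hm : ω < m) (x : X) :
    IntegrableOn (fun τ => Real.exp (-(m * τ)) • S τ x) (Ioi 0) := by
  refine Integrable.mono' ((integrableOn_exp_neg_mul (sub_pos.2 hm)).mul_const ‖x‖) ?_ ?_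
  · refine ContinuousOn.aestronglyMeasurable ?_ measurableSet_Ioi
    refine ContinuousOn.smul (by fun_prop) ?_
    exact (continuousOn_apply hS x).mono Ioi_subset_Ici_self
  · filter_upwards [ae_restrict_mem measurableSet_Ioi] with τ hτ
    exact norm_laplace_integrand_le hS (le_of_lt hτ) x

open Classical in
/-- The Laplace transform `∫₀^∞ e^{-m τ} S τ dτ` of a semigroup of growth `ω < m`. -/
def laplace (S : C0Semigroup X) (ω m : ℝ) : X →L[ℝ] X :=
  if h : S.HasGrowth ω ∧ ω < m then
    LinearMap.mkContinuous
      { toFun := fun x => ∫ τ in Ioi (0 : ℝ), Real.exp (-(m * τ)) • S τ x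
        map_add' := fun x y => by
          simp only [map_add, smul_add]
          exact integral_add (laplace_integrable h.1 h.2 x) (laplace_integrable h.1 h.2 y)
        map_smul' := fun c x => by
          simp only [map_smul, RingHom.id_apply]
          rw [← integral_smul]
          simp only [smul_comm c] }
      (m - ω)⁻¹ (fun x => by
        refine (norm_integral_le_of_norm_le
          ((integrableOn_exp_neg_mul (sub_pos.2 h.2)).mul_const ‖x‖) ?_).trans_eq ?_
        · filter_upwards [ae_restrict_mem measurableSet_Ioi] with τ hτ
          exact norm_laplace_integrand_le h.1 (le_of_lt hτ) x
        · rw [integral_mul_const, integral_exp_neg_mul (sub_pos.2 h.2)])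
  else 0

theorem laplace_apply (hS : S.HasGrowth ω) (hm : ω < m) (x : X) :
    S.laplace ω m x = ∫ τ in Ioi (0 : ℝ), Real.exp (-(m * τ)) • S τ x := by
  simp [laplace, hS, hm]

theorem norm_laplace_le (hS : S.HasGrowth ω) (hm : ω < m) : ‖S.laplace ω m‖ ≤ (m - ω)⁻¹ := by
  rw [laplace, dif_pos ⟨hS, hm⟩]
  exact LinearMap.mkContinuous_norm_le _ (inv_nonneg.2 (sub_pos.2 hm).le) _

/-- The semigroup is only strongly continuous, so measurability comes from the joint continuity of
the action, not from the operator norm. -/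
theorem aestronglyMeasurable_action (hS : S.HasGrowth ω) {α : Type*} [MeasurableSpace α]
    {ν : Measure α} {r : α → ℝ} {f : α → X} (hr : AEStronglyMeasurable r ν)
    (hf : AEStronglyMeasurable f ν) (hr0 : ∀ᵐ a ∂ν, 0 ≤ r a) :
    AEStronglyMeasurable (fun a => S (r a) (f a)) ν := by
  refine ((continuous_max hS).comp_aestronglyMeasurable (hr.prodMk hf)).congr ?_
  filter_upwards [hr0] with a ha
  simp [ha]

theorem intervalIntegrable_convolution (hS : S.HasGrowth ω) {f : ℝ → X} {τ : ℝ} (hτ : 0 ≤ τ)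
    (hf : IntervalIntegrable f volume 0 τ) :
    IntervalIntegrable (fun σ => S (τ - σ) (f σ)) volume 0 τ := by
  rw [intervalIntegrable_iff_integrableOn_Ioc_of_le hτ] at hf ⊢
  refine Integrable.mono' (hf.norm.const_mul (Real.exp (|ω| * τ))) ?_ ?_
  · refine aestronglyMeasurable_action hS (by fun_prop) hf.aestronglyMeasurable ?_
    filter_upwards [ae_restrict_mem measurableSet_Ioc] with σ hσ using sub_nonneg.2 hσ.2
  · filter_upwards [ae_restrict_mem measurableSet_Ioc] with σ hσ
    exact norm_le_exp_abs hS (sub_nonneg.2 hσ.2) (by linarith [hσ.1]) _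

/-- The kernel whose iterated integrals give the Laplace transform of a convolution. -/
theorem laplace_kernel_integrable (hS : S.HasGrowth ω) (hm : ω < m) {f : ℝ → X}
    (hf : IntegrableOn f (Ioi 0)) :
    Integrable (fun z : ℝ × ℝ => Real.exp (-(m * z.1)) • S z.1 (f z.2))
      ((volume.restrict (Ioi 0)).prod (volume.restrict (Ioi 0))) := by
  have hpos : ∀ᵐ z : ℝ × ℝ ∂((volume.restrict (Ioi 0)).prod (volume.restrict (Ioi 0))),
      0 ≤ z.1 := by
    rw [Measure.prod_restrict]
    filter_upwards [ae_restrict_mem (measurableSet_Ioi.prod measurableSet_Ioi)] with z hz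
      using le_of_lt hz.1
  refine Integrable.mono' ((integrableOn_exp_neg_mul (sub_pos.2 hm)).mul_prod hf.norm) ?_ ?_
  · refine AEStronglyMeasurable.smul (by fun_prop) ?_
    exact aestronglyMeasurable_action hS (by fun_prop)
      hf.aestronglyMeasurable.comp_snd hpos
  · filter_upwards [hpos] with z hz
    exact norm_laplace_integrand_le hS hz _

variable [CompleteSpace X]

/-- The shear (τ, σ) ↦ (τ - σ, σ) preserves measure and carries the triangle 0 < σ < τ onto the
quadrant, where e^{-mτ} factors; Fubini then separates the two integrals. Integrability and value
come from the same computation. -/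
theorem laplace_convolution_aux (hS : S.HasGrowth ω) (hm : ω < m) {f : ℝ → X}
    (hf : IntegrableOn (fun σ => Real.exp (-(m * σ)) • f σ) (Ioi 0)) :
    IntegrableOn (fun τ => Real.exp (-(m * τ)) • ∫ σ in (0 : ℝ)..τ, S (τ - σ) (f σ)) (Ioi 0) ∧
    ∫ τ in Ioi (0 : ℝ), Real.exp (-(m * τ)) • ∫ σ in (0 : ℝ)..τ, S (τ - σ) (f σ) =
      S.laplace ω m (∫ σ in Ioi (0 : ℝ), Real.exp (-(m * σ)) • f σ) := by
  set k : ℝ × ℝ → X := fun z => Real.exp (-(m * z.1)) • S z.1 (Real.exp (-(m * z.2)) • f z.2)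
    with hk
  have hmeas : MeasurableSet (Ioi (0 : ℝ) ×ˢ Ioi (0 : ℝ)) := measurableSet_Ioi.prod measurableSet_Ioi
  have hkint := laplace_kernel_integrable hS hm hf
  have hH : Integrable (indicator (Ioi (0 : ℝ) ×ˢ Ioi (0 : ℝ)) k)
      ((volume : Measure ℝ).prod volume) := by
    rw [integrable_indicator_iff hmeas, IntegrableOn, ← Measure.prod_restrict]
    exact hkint
  have hmp := measurePreserving_sub_prod (volume : Measure ℝ) (volume : Measure ℝ)
  have hH' := hmp.integrable_comp_of_integrable hH
  have hinner : ∀ τ : ℝ, (∫ σ, ((indicator (Ioi (0 : ℝ) ×ˢ Ioi (0 : ℝ)) k) ∘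
      fun z : ℝ × ℝ => (z.1 - z.2, z.2)) (τ, σ)) =
      indicator (Ioi 0) (fun τ => Real.exp (-(m * τ)) • ∫ σ in (0 : ℝ)..τ, S (τ - σ) (f σ)) τ := by
    intro τ
    have h1 : (fun σ => ((indicator (Ioi (0 : ℝ) ×ˢ Ioi (0 : ℝ)) k) ∘
        fun z : ℝ × ℝ => (z.1 - z.2, z.2)) (τ, σ)) =
        indicator (Ioo 0 τ) (fun σ => Real.exp (-(m * τ)) • S (τ - σ) (f σ)) := by
      ext1 σ
      by_cases hσ : σ ∈ Ioo 0 τ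
      · rw [indicator_of_mem hσ, Function.comp_apply, indicator_of_mem]
        · simp only [hk, map_smul, smul_smul, ← Real.exp_add]
          congr 2; ring
        · exact ⟨sub_pos.2 hσ.2, hσ.1⟩
      · rw [indicator_of_notMem hσ, Function.comp_apply, indicator_of_notMem]
        exact fun h => hσ ⟨h.2, sub_pos.1 h.1⟩
    rw [h1, integral_indicator measurableSet_Ioo, integral_smul]
    by_cases hτ : 0 < τ
    · rw [indicator_of_mem (mem_Ioi.2 hτ), intervalIntegral.integral_of_le hτ.le,
        integral_Ioc_eq_integral_Ioo]
    · rw [indicator_of_notMem (by simpa using hτ), Ioo_eq_empty (by simpa using hτ)]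
      simp
  constructor
  · rw [← integrable_indicator_iff measurableSet_Ioi]
    refine hH'.integral_prod_left.congr (Eventually.of_forall fun τ => ?_)
    exact hinner τ
  · rw [← integral_indicator measurableSet_Ioi]
    calc _ = ∫ τ, ∫ σ, ((indicator (Ioi (0 : ℝ) ×ˢ Ioi (0 : ℝ)) k) ∘
          fun z : ℝ × ℝ => (z.1 - z.2, z.2)) (τ, σ) := by simp only [hinner]
      _ = ∫ z, ((indicator (Ioi (0 : ℝ) ×ˢ Ioi (0 : ℝ)) k) ∘
          fun z : ℝ × ℝ => (z.1 - z.2, z.2)) z ∂((volume : Measure ℝ).prod volume) :=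
        (integral_prod _ hH').symm
      _ = ∫ z, indicator (Ioi (0 : ℝ) ×ˢ Ioi (0 : ℝ)) k z ∂((volume : Measure ℝ).prod volume) := by
        conv_rhs => rw [← hmp.map_eq]
        rw [integral_map hmp.measurable.aemeasurable]
        · rfl
        · rw [hmp.map_eq]; exact hH.aestronglyMeasurable
      _ = ∫ z, k z ∂((volume.restrict (Ioi 0)).prod (volume.restrict (Ioi 0))) := by
        rw [integral_indicator hmeas, Measure.prod_restrict]
      _ = ∫ s in Ioi (0 : ℝ), ∫ σ in Ioi (0 : ℝ), k (s, σ) := integral_prod _ hkint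
      _ = _ := by
        rw [laplace_apply hS hm]
        refine integral_congr_ae (Eventually.of_forall fun s => ?_)
        simp only [hk]
        rw [integral_smul, (S s).integral_comp_comm hf]

theorem integrableOn_laplace_convolution (hS : S.HasGrowth ω) (hm : ω < m) {f : ℝ → X}
    (hf : IntegrableOn (fun σ => Real.exp (-(m * σ)) • f σ) (Ioi 0)) :
    IntegrableOn (fun τ => Real.exp (-(m * τ)) • ∫ σ in (0 : ℝ)..τ, S (τ - σ) (f σ)) (Ioi 0) :=
  (laplace_convolution_aux hS hm hf).1

theorem laplace_convolution (hS : S.HasGrowth ω) (hm : ω < m) {f : ℝ → X}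
    (hf : IntegrableOn (fun σ => Real.exp (-(m * σ)) • f σ) (Ioi 0)) :
    ∫ τ in Ioi (0 : ℝ), Real.exp (-(m * τ)) • ∫ σ in (0 : ℝ)..τ, S (τ - σ) (f σ) =
      S.laplace ω m (∫ σ in Ioi (0 : ℝ), Real.exp (-(m * σ)) • f σ) :=
  (laplace_convolution_aux hS hm hf).2

end C0Semigroup

end Semigroup

/-! ## Generators -/

theorem measurePreserving_add_Ioi (h : ℝ) :
    MeasurePreserving (fun τ : ℝ => τ + h) (volume.restrict (Ioi 0)) (volume.restrict (Ioi h)) := by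
  have := (measurePreserving_add_right volume h).restrict_preimage (measurableSet_Ioi (a := h))
  rwa [preimage_add_const_Ioi, sub_self] at this

namespace IsInfinitesimalGenerator

variable {X : Type*} [NormedAddCommGroup X] [NormedSpace ℝ X]
  {S : C0Semigroup X} {A : X →ₗ.[ℝ] X} {ω m : ℝ}

theorem tendsto_apply (hA : IsInfinitesimalGenerator S A) (x : A.domain) :
    Tendsto (fun h : ℝ => h⁻¹ • (S h x - x)) (𝓝[>] 0) (𝓝 (A x)) :=
  (hA x (A x)).1 (A.mem_graph x)

theorem exists_apply_eq (hA : IsInfinitesimalGenerator S A) {x y : X}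
    (h : Tendsto (fun h : ℝ => h⁻¹ • (S h x - x)) (𝓝[>] 0) (𝓝 y)) :
    ∃ hx : x ∈ A.domain, A ⟨x, hx⟩ = y := by
  obtain ⟨z, hz, hz'⟩ := (LinearPMap.mem_graph_iff A).1 ((hA x y).2 h)
  simp only at hz hz'
  subst hz
  exact ⟨z.2, hz'⟩

theorem semigroup_apply (hA : IsInfinitesimalGenerator S A) (x : A.domain) {τ : ℝ} (hτ : 0 ≤ τ) :
    ∃ hx : S τ x ∈ A.domain, A ⟨S τ x, hx⟩ = S τ (A x) := by
  apply hA.exists_apply_eq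
  refine (((S τ).continuous.tendsto _).comp (hA.tendsto_apply x)).congr' ?_
  filter_upwards [self_mem_nhdsWithin] with h hh
  have hh0 : 0 ≤ h := le_of_lt hh
  rw [Function.comp_apply, map_smul, map_sub, ← S.apply_add hτ hh0, ← S.apply_add hh0 hτ, add_comm]

/-- The right derivative follows directly from the generator, and with continuity of the orbit it is
enough for the fundamental theorem of calculus. -/
theorem hasDerivWithinAt (hA : IsInfinitesimalGenerator S A) (x : A.domain) {τ : ℝ} (hτ : 0 ≤ τ) :
    HasDerivWithinAt (fun t => S t x) (S τ (A x)) (Ioi τ) τ := by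
  rw [hasDerivWithinAt_iff_tendsto_slope' (self_notMem_Ioi (a := τ))]
  have hsub : Tendsto (fun s : ℝ => s - τ) (𝓝[>] τ) (𝓝[>] 0) := by
    refine tendsto_nhdsWithin_iff.2 ⟨?_, ?_⟩
    · have : Continuous fun s : ℝ => s - τ := by fun_prop
      simpa using (this.tendsto τ).mono_left nhdsWithin_le_nhds
    · filter_upwards [self_mem_nhdsWithin] with s hs using mem_Ioi.2 (sub_pos.2 (mem_Ioi.1 hs))
  refine (((S τ).continuous.tendsto _).comp ((hA.tendsto_apply x).comp hsub)).congr' ?_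
  filter_upwards [self_mem_nhdsWithin] with s hs
  have hs0 : 0 ≤ s - τ := (sub_pos.2 (mem_Ioi.1 hs)).le
  rw [Function.comp_apply, Function.comp_apply, map_smul, map_sub, ← S.apply_add hτ hs0,
    slope_def_module]
  congr 4; ring

variable [CompleteSpace X]

theorem integral_semigroup (hA : IsInfinitesimalGenerator S A) (hS : S.HasGrowth ω) (x : A.domain)
    {T : ℝ} (hT : 0 ≤ T) : ∫ s in (0 : ℝ)..T, S s (A x) = S T x - x := by
  have hc : ∀ y, ContinuousOn (fun s => S s y) (Icc 0 T) := fun y =>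
    (C0Semigroup.continuousOn_apply hS y).mono Icc_subset_Ici_self
  rw [intervalIntegral.integral_eq_sub_of_hasDeriv_right_of_le hT (hc x)
    (fun s hs => hA.hasDerivWithinAt x hs.1.le)
    ((hc _).intervalIntegrable_of_Icc hT), S.apply_zero]

/-- A stationary pair `A x + b = 0` gives a constant mild solution. -/
theorem stationary (hA : IsInfinitesimalGenerator S A) (hS : S.HasGrowth ω) (x : A.domain) {b : X}
    (hb : A x + b = 0) {τ : ℝ} (hτ : 0 ≤ τ) :
    S τ x + ∫ σ in (0 : ℝ)..τ, S (τ - σ) b = x := by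
  have hb' : b = -A x := eq_neg_of_add_eq_zero_right hb
  rw [intervalIntegral.integral_comp_sub_left (fun σ => S σ b), sub_self, sub_zero, hb']
  simp only [map_neg]
  rw [intervalIntegral.integral_neg, hA.integral_semigroup hS x hτ]
  abel

/-- The integrand is minus the right derivative of e^{-ms} S s x, which decays to 0 since ω < m. -/
theorem laplace_sub (hA : IsInfinitesimalGenerator S A) (hS : S.HasGrowth ω) (hm : ω < m)
    (x : A.domain) : S.laplace ω m (m • (x : X) - A x) = x := by
  have hint := C0Semigroup.laplace_integrable hS hm (m • (x : X) - A x)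
  have hc : ∀ (y : X) (T : ℝ),
      ContinuousOn (fun s => Real.exp (-(m * s)) • S s y) (Icc 0 T) := fun y T =>
    ContinuousOn.smul (by fun_prop)
      ((C0Semigroup.continuousOn_apply hS y).mono Icc_subset_Ici_self)
  have hlim := intervalIntegral_tendsto_integral_Ioi 0 hint tendsto_id
  have hval : ∀ T : ℝ, 0 ≤ T → ∫ s in (0 : ℝ)..T, Real.exp (-(m * s)) • S s (m • (x : X) - A x) =
      x - Real.exp (-(m * T)) • S T x := by
    intro T hT
    have := intervalIntegral.integral_eq_sub_of_hasDeriv_right_of_le hT (hc x T)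
      (f' := fun s => -(Real.exp (-(m * s)) • S s (m • (x : X) - A x)))
      (fun s hs => by
        have he : HasDerivAt (fun s : ℝ => Real.exp (-(m * s))) (Real.exp (-(m * s)) * -m) s := by
          have := ((hasDerivAt_id s).const_mul m).neg.exp
          simpa using this
        refine (he.hasDerivWithinAt.smul (hA.hasDerivWithinAt x hs.1.le)).congr_deriv ?_
        rw [map_sub, map_smul]
        module)
      ((hc _ T).neg.intervalIntegrable_of_Icc hT)
    rw [intervalIntegral.integral_neg, S.apply_zero] at this
    rw [neg_eq_iff_eq_neg] at this
    simpa using this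
  have hzero : Tendsto (fun T : ℝ => Real.exp (-(m * T)) • S T x) atTop (𝓝 0) := by
    refine squeeze_zero_norm' (a := fun T => Real.exp (-(m - ω) * T) * ‖(x : X)‖) ?_ ?_
    · filter_upwards [eventually_ge_atTop 0] with T hT
        using C0Semigroup.norm_laplace_integrand_le hS hT _
    · have : Tendsto (fun T : ℝ => Real.exp (-(m - ω) * T)) atTop (𝓝 0) :=
        Real.tendsto_exp_atBot.comp (tendsto_id.const_mul_atTop_of_neg (by linarith))
      simpa using this.mul_const ‖(x : X)‖
  rw [C0Semigroup.laplace_apply hS hm]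
  refine tendsto_nhds_unique hlim ?_
  have h2 : Tendsto (fun T : ℝ => (x : X) - Real.exp (-(m * T)) • S T x) atTop (𝓝 x) := by
    simpa using hzero.const_sub (x : X)
  refine h2.congr' ?_
  filter_upwards [eventually_ge_atTop 0] with T hT using (hval T hT).symm

/-- Applying e^{-mh} S h translates the Laplace integral to (h, ∞), so the difference is the piece
over (0, h]. This one identity yields both the action of A on the range of the Laplace transform and
the density of the domain. -/
theorem semigroup_laplace (hS : S.HasGrowth ω) (hm : ω < m) (x : X) {h : ℝ} (hh : 0 ≤ h) :
    S.laplace ω m x - Real.exp (-(m * h)) • S h (S.laplace ω m x) =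
      ∫ τ in (0 : ℝ)..h, Real.exp (-(m * τ)) • S τ x := by
  have hint := C0Semigroup.laplace_integrable hS hm x
  have h1 : Real.exp (-(m * h)) • S h (S.laplace ω m x) =
      ∫ τ in Ioi h, Real.exp (-(m * τ)) • S τ x := by
    rw [← (measurePreserving_add_Ioi h).integral_comp (measurableEmbedding_addRight h), C0Semigroup.laplace_apply hS hm, ← (S h).integral_comp_comm hint, ← integral_smul]
    refine setIntegral_congr_fun measurableSet_Ioi fun τ hτ => ?_
    simp only [map_smul, smul_smul, ← Real.exp_add]
    rw [add_comm τ h, S.apply_add hh (le_of_lt hτ)]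
    congr 2; ring
  rw [h1, C0Semigroup.laplace_apply hS hm, intervalIntegral.integral_of_le hh,
    ← Ioc_union_Ioi_eq_Ioi hh, setIntegral_union (Ioc_disjoint_Ioi le_rfl) measurableSet_Ioi
      (hint.mono_set Ioc_subset_Ioi_self) (hint.mono_set (Ioi_subset_Ioi hh))]
  abel

theorem tendsto_average (hS : S.HasGrowth ω) (m : ℝ) (x : X) :
    Tendsto (fun h : ℝ => h⁻¹ • ∫ τ in (0 : ℝ)..h, Real.exp (-(m * τ)) • S τ x)
      (𝓝[>] 0) (𝓝 x) := by
  -- The truncation at 0 makes the integrand continuous on the whole line; it changes nothing on [0,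
  -- h].
  have hc : Continuous fun τ : ℝ => Real.exp (-(m * τ)) • S (max τ 0) x :=
    Continuous.smul (by fun_prop) ((C0Semigroup.continuous_max hS).comp (Continuous.prodMk_left x))
  have hd := (hc.integral_hasStrictDerivAt 0 0).hasDerivAt.tendsto_slope_zero_right
  simp only [zero_add, intervalIntegral.integral_same, sub_zero, mul_zero, neg_zero, Real.exp_zero,
    one_smul, max_self, S.apply_zero] at hd
  refine hd.congr' ?_
  filter_upwards [self_mem_nhdsWithin] with h hh
  congr 1
  refine intervalIntegral.integral_congr fun τ hτ => ?_
  rw [uIcc_of_le (le_of_lt hh)] at hτ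
  simp [hτ.1]

theorem exists_apply_laplace (hA : IsInfinitesimalGenerator S A) (hS : S.HasGrowth ω) (hm : ω < m)
    (x : X) : ∃ hx : S.laplace ω m x ∈ A.domain,
      A ⟨S.laplace ω m x, hx⟩ = m • S.laplace ω m x - x := by
  apply hA.exists_apply_eq
  set R := S.laplace ω m x
  have hexp : Tendsto (fun h : ℝ => Real.exp (m * h)) (𝓝[>] 0) (𝓝 1) := by
    have : Continuous fun h : ℝ => Real.exp (m * h) := by fun_prop
    simpa using (this.tendsto 0).mono_left nhdsWithin_le_nhds
  have hslope : Tendsto (fun h : ℝ => h⁻¹ • (Real.exp (m * h) - 1)) (𝓝[>] 0) (𝓝 m) := by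
    have he : HasDerivAt (fun s : ℝ => Real.exp (m * s)) m 0 := by
      simpa using ((hasDerivAt_id (0 : ℝ)).const_mul m).exp
    simpa using he.tendsto_slope_zero_right
  have h := (hslope.smul_const R).sub (hexp.smul (tendsto_average hS m x))
  rw [one_smul] at h
  refine h.congr' ?_
  filter_upwards [self_mem_nhdsWithin] with h hh
  rw [← semigroup_laplace hS hm x (le_of_lt hh)]
  have he : Real.exp (m * h) * Real.exp (-(m * h)) = 1 := by rw [← Real.exp_add]; simp
  have hSR : Real.exp (m * h) • (Real.exp (-(m * h)) • S h R) = S h R := by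
    rw [smul_smul, he, one_smul]
  rw [smul_comm (Real.exp (m * h)) h⁻¹, smul_sub (Real.exp (m * h)), hSR, smul_eq_mul]
  module

/-- The averages of e^{-mτ} S τ x over [0, h] converge to x, and by `semigroup_laplace` they are
combinations of domain elements. -/
theorem dense_domain (hA : IsInfinitesimalGenerator S A) (hS : S.HasGrowth ω) :
    Dense (A.domain : Set X) := by
  intro x
  have hm : ω < ω + 1 := lt_add_one ω
  refine mem_closure_of_tendsto (tendsto_average hS (ω + 1) x) ?_
  filter_upwards [self_mem_nhdsWithin] with h hh
  have hh0 : 0 ≤ h := le_of_lt hh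
  obtain ⟨hR, -⟩ := hA.exists_apply_laplace hS hm x
  obtain ⟨hSR, -⟩ := hA.semigroup_apply ⟨_, hR⟩ hh0
  rw [← semigroup_laplace hS hm x hh0]
  exact A.domain.smul_mem _ (A.domain.sub_mem hR (A.domain.smul_mem _ hSR))

end IsInfinitesimalGenerator

/-! ## The adjoint resolvent -/

section Adjoint

variable {V : Type*} [NormedAddCommGroup V] [InnerProductSpace ℝ V]

theorem eq_of_forall_dual_eq {v w : V} (h : ∀ x : StrongDual ℝ V, x v = x w) : v = w :=
  ext_inner_left ℝ fun z => h (innerSL ℝ z)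

variable [CompleteSpace V]

/-- The adjoint `V → V`, in the duality between `V` and `V'`, of a bounded operator on `V'`. -/
def primalAdjoint (R : StrongDual ℝ V →L[ℝ] StrongDual ℝ V) : V →L[ℝ] V :=
  LinearMap.mkContinuous
    { toFun := fun v => bidualToPrimal ((ContinuousLinearMap.apply ℝ ℝ v).comp R)
      map_add' := fun v w => by
        refine eq_of_forall_dual_eq fun x => ?_
        rw [map_add x, apply_bidualToPrimal, apply_bidualToPrimal, apply_bidualToPrimal]
        simp
      map_smul' := fun c v => by
        refine eq_of_forall_dual_eq fun x => ?_
        rw [map_smul x, apply_bidualToPrimal, apply_bidualToPrimal]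
        simp }
    ‖R‖ (fun v => by
      set w := bidualToPrimal ((ContinuousLinearMap.apply ℝ ℝ v).comp R) with hw
      change ‖w‖ ≤ _
      have h := apply_bidualToPrimal ((ContinuousLinearMap.apply ℝ ℝ v).comp R) (innerSL ℝ w)
      rw [← hw, innerSL_apply_apply, real_inner_self_eq_norm_sq] at h
      have h1 : ‖w‖ ^ 2 ≤ ‖R‖ * ‖w‖ * ‖v‖ := by
        rw [h]
        calc R (innerSL ℝ w) v ≤ ‖R (innerSL ℝ w) v‖ := le_abs_self _
          _ ≤ ‖R (innerSL ℝ w)‖ * ‖v‖ := ContinuousLinearMap.le_opNorm _ _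
          _ ≤ ‖R‖ * ‖innerSL ℝ w‖ * ‖v‖ := by gcongr; exact R.le_opNorm _
          _ = _ := by rw [innerSL_apply_norm]
      rcases eq_or_lt_of_le (norm_nonneg w) with h0 | h0
      · rw [← h0]; positivity
      · nlinarith)

theorem apply_primalAdjoint (R : StrongDual ℝ V →L[ℝ] StrongDual ℝ V) (v : V)
    (x : StrongDual ℝ V) : x (primalAdjoint R v) = R x v :=
  apply_bidualToPrimal ((ContinuousLinearMap.apply ℝ ℝ v).comp R) x

theorem norm_primalAdjoint_le (R : StrongDual ℝ V →L[ℝ] StrongDual ℝ V) : ‖primalAdjoint R‖ ≤ ‖R‖ :=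
  LinearMap.mkContinuous_norm_le _ (norm_nonneg R) _

variable {S : C0Semigroup (StrongDual ℝ V)} {A : StrongDual ℝ V →ₗ.[ℝ] StrongDual ℝ V} {ω m : ℝ}

/-- Transposition swaps the two resolvent identities: R(m - A) = 1 on D(A) becomes the right inverse
on V, and (m - A)R = 1 becomes the left inverse. -/
theorem isResolventOperator_primalAdjoint (hA : IsInfinitesimalGenerator S A) (hS : S.HasGrowth ω)
    (hm : ω < m) :
    IsResolventOperator (dualityAdjoint A) m (primalAdjoint (S.laplace ω m)) := by
  have hgraph := dualityAdjoint_graph A (hA.dense_domain hS)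
  constructor
  · intro v
    set r := primalAdjoint (S.laplace ω m) v with hr
    have hmem : (r, m • r - v) ∈ (dualityAdjoint A).graph := by
      rw [hgraph]
      intro x
      have hx := congrArg (fun z : StrongDual ℝ V => z v) (hA.laplace_sub hS hm x)
      simp only [map_sub, map_smul, _root_.sub_apply, _root_.smul_apply]
        at hx
      simp only [hr, map_sub, map_smul, apply_primalAdjoint]
      linarith
    obtain ⟨z, hz, hz'⟩ := (LinearPMap.mem_graph_iff _).1 hmem
    simp only at hz hz'
    have hdom : r ∈ (dualityAdjoint A).domain := hz ▸ z.2
    refine ⟨hdom, ?_⟩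
    have : z = ⟨r, hdom⟩ := Subtype.ext hz
    rw [← this, hz']
    abel
  · intro v
    have hmem := (dualityAdjoint A).mem_graph v
    rw [hgraph] at hmem
    refine eq_of_forall_dual_eq fun y => ?_
    obtain ⟨hy, hAy⟩ := hA.exists_apply_laplace hS hm y
    have := hmem ⟨_, hy⟩
    rw [hAy] at this
    simp only [_root_.sub_apply, _root_.smul_apply] at this
    rw [apply_primalAdjoint, map_sub, map_smul, ← this]
    simp

theorem IsResolventOperator.unique {X : Type*} [NormedAddCommGroup X] [NormedSpace ℝ X]
    {T : X →ₗ.[ℝ] X} {R R' : X →L[ℝ] X} (h : IsResolventOperator T m R)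
    (h' : IsResolventOperator T m R') : R = R' := by
  ext v
  obtain ⟨hv, hv'⟩ := h.1 v
  have := h'.2 ⟨R v, hv⟩
  rw [hv'] at this
  exact this.symm

theorem resolventOp_dualityAdjoint (hA : IsInfinitesimalGenerator S A) (hS : S.HasGrowth ω)
    (hm : ω < m) : resolventOp (dualityAdjoint A) m = primalAdjoint (S.laplace ω m) := by
  have hR := isResolventOperator_primalAdjoint hA hS hm
  have hmem : InResolventSet (dualityAdjoint A) m := ⟨_, hR⟩
  rw [resolventOp, dif_pos hmem]
  exact hmem.choose_spec.unique hR

theorem tendsto_norm_primalAdjoint_laplace (hS : S.HasGrowth ω) :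
    Tendsto (fun m => ‖primalAdjoint (S.laplace ω m)‖) atTop (𝓝 0) := by
  refine squeeze_zero' (g := fun m => (m - ω)⁻¹) (Eventually.of_forall fun _ => norm_nonneg _) ?_ ?_
  · filter_upwards [eventually_gt_atTop ω] with m hm
      using (norm_primalAdjoint_le _).trans (C0Semigroup.norm_laplace_le hS hm)
  · exact tendsto_inv_atTop_zero.comp (tendsto_atTop_add_const_right _ (-ω) tendsto_id)

theorem tendsto_primalAdjoint_laplace (hS : S.HasGrowth ω) (v : V) :
    Tendsto (fun m => primalAdjoint (S.laplace ω m) v) atTop (𝓝 0) := by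
  refine squeeze_zero_norm (fun m => ContinuousLinearMap.le_opNorm _ v) ?_
  simpa using (tendsto_norm_primalAdjoint_laplace hS).mul_const ‖v‖

/-- A vector orthogonal to the domain annihilates the range of R*, so its functional is killed by R.
Since R is injective, the vector vanishes. -/
theorem dense_domain_dualityAdjoint (hA : IsInfinitesimalGenerator S A) (hS : S.HasGrowth ω) :
    Dense ((dualityAdjoint A).domain : Set V) := by
  rw [Submodule.dense_iff_topologicalClosure_eq_top,
    Submodule.topologicalClosure_eq_top_iff, Submodule.eq_bot_iff]
  intro z hz
  have hm : ω < ω + 1 := lt_add_one ω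
  have hR := isResolventOperator_primalAdjoint hA hS hm
  have h0 : S.laplace ω (ω + 1) (innerSL ℝ z) = 0 := by
    ext v
    obtain ⟨hv, -⟩ := hR.1 v
    rw [← apply_primalAdjoint, innerSL_apply_apply, _root_.zero_apply]
    exact Submodule.inner_left_of_mem_orthogonal hv hz
  obtain ⟨hy, hAy⟩ := hA.exists_apply_laplace hS hm (innerSL ℝ z)
  have h1 : (⟨_, hy⟩ : A.domain) = 0 := Subtype.ext h0
  rw [h1, LinearPMap.map_zero, h0, smul_zero, zero_sub, eq_comm, neg_eq_zero] at hAy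
  have := congrArg (fun x : StrongDual ℝ V => x z) hAy
  simpa using this

/-- Yosida approximation: on D(A₁*) one has m R(m)*w - w = R(m)*A₁*w → 0, and the bound m/(m - ω) ≤
2 for large m extends the limit by density. -/
theorem tendsto_smul_primalAdjoint_laplace (hA : IsInfinitesimalGenerator S A)
    (hS : S.HasGrowth ω) (v : V) :
    Tendsto (fun m => m • primalAdjoint (S.laplace ω m) v) atTop (𝓝 v) := by
  have hdom : ∀ w : (dualityAdjoint A).domain,
      Tendsto (fun m => m • primalAdjoint (S.laplace ω m) w - w) atTop (𝓝 0) := by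
    intro w
    refine (tendsto_primalAdjoint_laplace hS (dualityAdjoint A w)).congr' ?_
    filter_upwards [eventually_gt_atTop ω] with m hm
    have := (isResolventOperator_primalAdjoint hA hS hm).2 w
    rw [map_sub, map_smul, sub_eq_iff_eq_add] at this
    rw [this]; abel
  have hbound : ∀ᶠ m in atTop, ‖m • primalAdjoint (S.laplace ω m)‖ ≤ 2 := by
    filter_upwards [eventually_gt_atTop ω, eventually_ge_atTop 0, eventually_ge_atTop (2 * ω)]
      with m hm h0 h2
    rw [norm_smul, Real.norm_of_nonneg h0]
    have h3 := (norm_primalAdjoint_le _).trans (C0Semigroup.norm_laplace_le hS hm)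
    calc _ ≤ m * (m - ω)⁻¹ := by gcongr
      _ ≤ 2 := by
        rw [← div_eq_mul_inv, div_le_iff₀ (sub_pos.2 hm)]; linarith
  rw [Metric.tendsto_nhds]
  intro ε hε
  obtain ⟨w, hw, hwv⟩ := (dense_domain_dualityAdjoint hA hS).exists_dist_lt v
    (show (0 : ℝ) < ε / 4 by positivity)
  have hd := Metric.tendsto_nhds.1 (hdom ⟨w, hw⟩) (ε / 4) (by positivity)
  filter_upwards [hd, hbound] with m h1 h2
  rw [dist_zero_right] at h1
  rw [dist_eq_norm] at hwv ⊢
  have h3 : m • primalAdjoint (S.laplace ω m) v - v =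
      (m • primalAdjoint (S.laplace ω m)) (v - w) +
        (m • primalAdjoint (S.laplace ω m) w - w) - (v - w) := by
    simp only [_root_.smul_apply, map_sub]
    abel
  have h4 : ‖(m • primalAdjoint (S.laplace ω m)) (v - w)‖ ≤ 2 * ‖v - w‖ :=
    (ContinuousLinearMap.le_opNorm _ _).trans (by gcongr)
  rw [h3]
  have h5 := norm_sub_le ((m • primalAdjoint (S.laplace ω m)) (v - w) +
        (m • primalAdjoint (S.laplace ω m) w - w)) (v - w)
  have h6 := norm_add_le ((m • primalAdjoint (S.laplace ω m)) (v - w))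
    (m • primalAdjoint (S.laplace ω m) w - w)
  linarith

end Adjoint

/-! ## Convex functions -/

theorem ConvexOn.add_fderiv_le {X : Type*} [NormedAddCommGroup X] [NormedSpace ℝ X] {f : X → ℝ}
    (hf : ConvexOn ℝ univ f) {x : X} (hx : DifferentiableAt ℝ f x) (y : X) :
    f x + fderiv ℝ f x (y - x) ≤ f y := by
  have hlim := (hx.hasFDerivAt.hasLineDerivAt (y - x)).tendsto_slope_zero_right
  have hle : fderiv ℝ f x (y - x) ≤ f y - f x := by
    refine le_of_tendsto hlim ?_
    filter_upwards [Ioo_mem_nhdsGT (zero_lt_one (α := ℝ))] with t ht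
    have hc := hf.2 (mem_univ x) (mem_univ y) (sub_nonneg.2 ht.2.le) ht.1.le (by ring)
    have he : (1 - t) • x + t • y = x + t • (y - x) := by module
    rw [he] at hc
    rw [smul_eq_mul, smul_eq_mul] at hc
    rw [smul_eq_mul]
    rw [inv_mul_le_iff₀ ht.1]
    linarith
  linarith

/-- The gradient inequality based at y, after replacing the derivative at y by that at x at
Lipschitz cost. No integration along the segment is needed, at the price of K in place of K/2. -/
theorem ConvexOn.le_add_fderiv_add_sq {X : Type*} [NormedAddCommGroup X] [NormedSpace ℝ X]
    {f : X → ℝ} (hf : ConvexOn ℝ univ f) (hd : Differentiable ℝ f) {K : NNReal}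
    (hK : LipschitzWith K (fderiv ℝ f)) (x y : X) :
    f y ≤ f x + fderiv ℝ f x (y - x) + K * ‖y - x‖ ^ 2 := by
  have h1 := hf.add_fderiv_le (hd y) x
  have h2 : fderiv ℝ f y (y - x) - fderiv ℝ f x (y - x) ≤ K * ‖y - x‖ ^ 2 := by
    rw [← _root_.sub_apply]
    calc _ ≤ ‖(fderiv ℝ f y - fderiv ℝ f x) (y - x)‖ := le_abs_self _
      _ ≤ ‖fderiv ℝ f y - fderiv ℝ f x‖ * ‖y - x‖ := ContinuousLinearMap.le_opNorm _ _
      _ ≤ K * ‖y - x‖ * ‖y - x‖ := by gcongr; exact hK.norm_sub_le y x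
      _ = _ := by ring
  have h3 : fderiv ℝ f y (x - y) = -fderiv ℝ f y (y - x) := by rw [← map_neg, neg_sub]
  linarith

theorem exists_mul_le_rpow_add {a p : ℝ} (ha : 0 < a) (hp : 1 < p) (C : ℝ) :
    ∃ D : ℝ, ∀ r : ℝ, 0 ≤ r → C * r ≤ a * r ^ p + D := by
  set C' := max C 0
  have hC' : 0 ≤ C' := le_max_right _ _
  -- Beyond r₀ one has a r^{p-1} ≥ C', so the power dominates; below it the constant C' r₀ suffices.
  set r₀ : ℝ := (C' / a) ^ (p - 1)⁻¹ with hr₀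
  refine ⟨C' * r₀, fun r hr => (mul_le_mul_of_nonneg_right (le_max_left C 0) hr).trans ?_⟩
  change C' * r ≤ _
  have hr₀0 : 0 ≤ r₀ := by positivity
  have hrp : 0 ≤ r ^ p := by positivity
  rcases le_total r r₀ with h | h
  · have := mul_le_mul_of_nonneg_left h hC'
    nlinarith
  · rcases hr.eq_or_lt with h0 | h0
    · rw [← h0, mul_zero]; positivity
    have h1 : C' / a ≤ r ^ (p - 1) := by
      calc C' / a = r₀ ^ (p - 1) := by
            rw [hr₀, ← Real.rpow_mul (by positivity), inv_mul_cancel₀ (by linarith), Real.rpow_one]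
        _ ≤ _ := Real.rpow_le_rpow hr₀0 h (by linarith)
    rw [div_le_iff₀ ha] at h1
    have h2 : r ^ p = r ^ (p - 1) * r := by
      rw [← Real.rpow_add_one h0.ne']; congr 1; ring
    have h3 := mul_le_mul_of_nonneg_right h1 hr
    have h4 : 0 ≤ C' * r₀ := by positivity
    rw [h2]; nlinarith

/-- Superlinear growth: `h` dominates every multiple of the norm up to a constant. -/
def IsSuperlinear {U : Type*} [NormedAddCommGroup U] (h : U → ℝ) : Prop :=
  ∀ C : ℝ, ∃ D : ℝ, ∀ u : U, C * ‖u‖ - D ≤ h u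

theorem isSuperlinear_of_rpow_le {U : Type*} [NormedAddCommGroup U] {h : U → ℝ}
    {a b p : ℝ} (ha : 0 < a) (hp : 1 < p)
    (hh : ∀ u : U, a * ‖u‖ ^ p + b ≤ h u) : IsSuperlinear h := by
  intro C
  obtain ⟨D, hD⟩ := exists_mul_le_rpow_add ha hp C
  exact ⟨D - b, fun u => by linarith [hD ‖u‖ (norm_nonneg u), hh u]⟩

/-! ### Convex conjugates of superlinear functions. -/

section Conjugate

variable {U : Type*} [NormedAddCommGroup U] [InnerProductSpace ℝ U] {h : U → ℝ}

theorem IsSuperlinear.bddAbove (hh : IsSuperlinear h) (w : U) :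
    BddAbove (range fun u : U => ⟪w, u⟫ - h u) := by
  obtain ⟨D, hD⟩ := hh ‖w‖
  refine ⟨D, ?_⟩
  rintro _ ⟨u, rfl⟩
  linarith [hD u, real_inner_le_norm w u]

/-- Inverse relation between the gradient of the conjugate and the subdifferential. -/
theorem mem_subdiff_gradient_convexConj [CompleteSpace U] (hc : ConvexOn ℝ univ h)
    (hl : LowerSemicontinuous h) (hh : IsSuperlinear h) (hs : IsSigmaZero (convexConj h)) (w : U) :
    w ∈ subdiff h (gradient (convexConj h) w) := by
  intro v
  set u := gradient (convexConj h) w with hu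
  have hgrad : ∀ w', convexConj h w + ⟪u, w' - w⟫ ≤ convexConj h w' := by
    intro w'
    have := hs.1.add_fderiv_le (hs.2.1 w) w'
    rwa [hu, gradient, InnerProductSpace.toDual_symm_apply]
  have hle : ∀ w' v', ⟪w', v'⟫ - h v' ≤ convexConj h w' := fun w' v' =>
    le_ciSup (hh.bddAbove w') v'
  -- Fenchel equality at u, by biconjugation: an affine minorant l + c of h that nearly touches at u
  -- has a slope w' with h*(w') ≤ -c, and the gradient inequality of h* between w and w' bounds l u
  -- + c.
  have hfm : h u ≤ ⟪w, u⟫ - convexConj h w := by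
    refine le_of_forall_lt fun a ha => ?_
    obtain ⟨a', haa', ha'⟩ := exists_between ha
    refine lt_of_lt_of_le haa' ?_
    obtain ⟨l, c, hlc, hx⟩ := ConvexOn.exists_affine_le_of_lt (𝕜 := ℝ) (mem_univ u) ha'
      isClosed_univ (lowerSemicontinuousOn_univ_iff.2 hl) hc
    set w' := (InnerProductSpace.toDual ℝ U).symm l with hw'
    have hl' : ∀ v, l v = ⟪w', v⟫ := fun v => (InnerProductSpace.toDual_symm_apply).symm
    have h1 : convexConj h w' ≤ -c := by
      refine ciSup_le fun v => ?_
      have := hlc ⟨v, mem_univ v⟩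
      simp only [Pi.add_apply, domRestrict_apply, Function.comp_apply, Function.const_apply,
        RCLike.re_to_real, hl'] at this
      linarith
    have h2 := hgrad w'
    rw [RCLike.re_to_real, hl'] at hx
    rw [inner_sub_right, real_inner_comm w' u, real_inner_comm w u] at h2
    linarith
  have := hle w v
  rw [inner_sub_right]
  linarith

end Conjugate

/-! ## The extended integral -/

theorem extendedIntegral_mono {t : ℝ} {f g : ℝ → ℝ} (h : ∀ τ ∈ Ioi t, f τ ≤ g τ) :
    extendedIntegral t f ≤ extendedIntegral t g := by
  refine EReal.sub_le_sub ?_ ?_ <;> rw [EReal.coe_ennreal_le_coe_ennreal_iff]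
  · exact setLIntegral_mono' measurableSet_Ioi fun τ hτ => ENNReal.ofReal_le_ofReal (h τ hτ)
  · exact setLIntegral_mono' measurableSet_Ioi fun τ hτ =>
      ENNReal.ofReal_le_ofReal (neg_le_neg (h τ hτ))

theorem extendedIntegral_congr {t : ℝ} {f g : ℝ → ℝ} (h : ∀ τ ∈ Ioi t, f τ = g τ) :
    extendedIntegral t f = extendedIntegral t g :=
  le_antisymm (extendedIntegral_mono fun τ hτ => (h τ hτ).le)
    (extendedIntegral_mono fun τ hτ => (h τ hτ).ge)

theorem extendedIntegral_eq_integral {t : ℝ} {f : ℝ → ℝ} (hf : IntegrableOn f (Ioi t)) :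
    extendedIntegral t f = ((∫ τ in Ioi t, f τ : ℝ) : EReal) := by
  rw [integral_eq_lintegral_pos_part_sub_lintegral_neg_part hf, EReal.coe_sub, extendedIntegral,
    EReal.coe_ennreal_toReal hf.lintegral_lt_top.ne,
    EReal.coe_ennreal_toReal (x := ∫⁻ τ in Ioi t, ENNReal.ofReal (-f τ))
      hf.neg.lintegral_lt_top.ne]

/-- The integrable minorant keeps the negative part finite, so an infinite positive part would force
the value ⊤. -/
theorem integrableOn_of_extendedIntegral_ne_top {t : ℝ} {f g : ℝ → ℝ}
    (hf : AEStronglyMeasurable f (volume.restrict (Ioi t))) (hg : IntegrableOn g (Ioi t))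
    (hgf : ∀ τ ∈ Ioi t, g τ ≤ f τ) (htop : extendedIntegral t f ≠ ⊤) : IntegrableOn f (Ioi t) := by
  have hneg : (∫⁻ τ in Ioi t, ENNReal.ofReal (-f τ)) ≠ ⊤ := by
    refine ((setLIntegral_mono' measurableSet_Ioi fun τ hτ =>
      ENNReal.ofReal_le_ofReal (neg_le_neg (hgf τ hτ))).trans_lt hg.neg.lintegral_lt_top).ne
  have hpos : (∫⁻ τ in Ioi t, ENNReal.ofReal (f τ)) ≠ ⊤ := by
    intro h
    apply htop
    rw [extendedIntegral, h, EReal.coe_ennreal_top, ← EReal.coe_ennreal_toReal hneg,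
      EReal.top_sub_coe]
  refine ⟨hf, ?_⟩
  rw [HasFiniteIntegral]
  refine lt_of_le_of_lt (b := ∫⁻ τ in Ioi t, (ENNReal.ofReal (f τ) + ENNReal.ofReal (-f τ))) ?_ ?_
  · refine lintegral_mono fun τ => ?_
    rw [Real.enorm_eq_ofReal_abs]
    rcases le_total 0 (f τ) with h | h
    · rw [abs_of_nonneg h]; exact le_self_add
    · rw [abs_of_nonpos h]; exact le_add_self
  · rw [lintegral_add_left' hf.aemeasurable.ennreal_ofReal]
    exact ENNReal.add_lt_top.2 ⟨hpos.lt_top, hneg.lt_top⟩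

/-! ## Admissible controls -/

section Admissible

variable {U : Type*} [NormedAddCommGroup U] [InnerProductSpace ℝ U] {p lam m : ℝ} {u : ℝ → U}

theorem IsAdmissible.aestronglyMeasurable (hu : IsAdmissible p lam 0 u) :
    AEStronglyMeasurable u (volume.restrict (Ioi 0)) := by
  have h : AEStronglyMeasurable
      (fun τ => Real.exp (lam * τ / p) • (Real.exp (-(lam * τ) / p) • u τ))
      (volume.restrict (Ioi 0)) := AEStronglyMeasurable.smul (by fun_prop) hu.1
  refine h.congr (Eventually.of_forall fun τ => ?_)
  simp only [smul_smul, ← Real.exp_add]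
  rw [neg_div, add_neg_cancel, Real.exp_zero, one_smul]

/-- With n = e^{-λτ/p}‖u(τ)‖ and κ = λ - λ/p > 0, the norm is at most e^{-κτ} n ≤ e^{-κτ} + n^p, by
cases n ≤ 1 and n ≥ 1; this stands in for Hölder. -/
theorem IsAdmissible.integrableOn_exp (hp : 1 < p) (hlam : 0 < lam) (hm : lam ≤ m)
    (hu : IsAdmissible p lam 0 u) :
    IntegrableOn (fun τ => Real.exp (-(m * τ)) • u τ) (Ioi 0) := by
  have hp0 : 0 < p := by linarith
  have hint := hu.integrable_norm_rpow (by simpa using hp0) ENNReal.ofReal_ne_top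
  rw [ENNReal.toReal_ofReal hp0.le] at hint
  have hκ : 0 < lam - lam / p := sub_pos.2 (div_lt_self hlam hp)
  refine Integrable.mono' ((integrableOn_exp_mul_Ioi (neg_lt_zero.2 hκ) 0).add hint)
    (AEStronglyMeasurable.smul (by fun_prop) hu.aestronglyMeasurable) ?_
  filter_upwards [ae_restrict_mem measurableSet_Ioi] with τ hτ
  have hτ0 : 0 < τ := hτ
  set n := ‖Real.exp (-(lam * τ) / p) • u τ‖ with hn
  have h1 : ‖Real.exp (-(m * τ)) • u τ‖ ≤ Real.exp (-(lam - lam / p) * τ) * n := by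
    rw [hn, norm_smul, norm_smul, Real.norm_eq_abs, Real.norm_eq_abs, Real.abs_exp, Real.abs_exp,
      ← mul_assoc, ← Real.exp_add]
    gcongr
    have : lam / p * τ = lam * τ / p := by ring
    rw [neg_div]; nlinarith
  have h2 : Real.exp (-(lam - lam / p) * τ) ≤ 1 := Real.exp_le_one_iff.2 (by nlinarith)
  have hn0 : 0 ≤ n := norm_nonneg _
  refine h1.trans ?_
  rw [Pi.add_apply]
  have h3 : 0 ≤ n ^ p := Real.rpow_nonneg hn0 p
  rcases le_total n 1 with h | h
  · have := mul_le_mul_of_nonneg_left h (Real.exp_pos (-(lam - lam / p) * τ)).le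
    linarith
  · have h4 : n ≤ n ^ p := Real.self_le_rpow_of_one_le h hp.le
    have := mul_le_mul_of_nonneg_right h2 hn0
    have := Real.exp_pos (-(lam - lam / p) * τ)
    linarith

theorem isAdmissible_const (hp : 0 < p) (hlam : 0 < lam) (u : U) :
    IsAdmissible p lam 0 (fun _ => u) := by
  have hp' : ENNReal.ofReal p ≠ 0 := by simpa using hp
  rw [IsAdmissible, ← integrable_norm_rpow_iff (Continuous.aestronglyMeasurable (by fun_prop))
    hp' ENNReal.ofReal_ne_top, ENNReal.toReal_ofReal hp.le]
  refine ((C0Semigroup.integrableOn_exp_neg_mul hlam).mul_const (‖u‖ ^ p)).congr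
    (Eventually.of_forall fun τ => ?_)
  simp only
  rw [norm_smul, Real.norm_eq_abs, Real.abs_exp, Real.mul_rpow (Real.exp_pos _).le (norm_nonneg _),
    ← Real.exp_mul]
  congr 2
  field_simp

theorem IsAdmissible.shift (hp : 0 < p) (hu : IsAdmissible p lam 0 u) {T : ℝ} (hT : 0 ≤ T) :
    IsAdmissible p lam 0 (fun σ => u (σ + T)) := by
  have h1 : MemLp (fun τ : ℝ => Real.exp (-(lam * τ) / p) • u τ) (ENNReal.ofReal p)
      (volume.restrict (Ioi T)) := hu.mono_measure (Measure.restrict_mono (Ioi_subset_Ioi hT) le_rfl)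
  have h2 := (h1.comp_measurePreserving (measurePreserving_add_Ioi T)).const_smul
    (Real.exp (lam * T / p))
  refine (memLp_congr_ae (Eventually.of_forall fun σ => ?_)).1 h2
  simp only [Pi.smul_apply, Function.comp_apply, smul_smul, ← Real.exp_add]
  congr 2
  field_simp
  ring

theorem intervalIntegrable_of_exp
    (hu : IntegrableOn (fun τ => Real.exp (-(m * τ)) • u τ) (Ioi 0)) {a b : ℝ} (ha : 0 ≤ a)
    (hab : a ≤ b) : IntervalIntegrable u volume a b := by
  have h1 : IntervalIntegrable (fun τ => Real.exp (-(m * τ)) • u τ) volume a b := by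
    rw [intervalIntegrable_iff_integrableOn_Ioc_of_le hab]
    exact hu.mono_set fun τ hτ => lt_of_le_of_lt ha hτ.1
  have h2 := h1.continuousOn_smul (f := fun τ : ℝ => Real.exp (m * τ)) (by fun_prop)
  refine h2.congr (fun τ _ => ?_)
  simp only [smul_smul, ← Real.exp_add]
  simp

theorem intervalIntegrable_clm_comp {E F : Type*} [NormedAddCommGroup E] [NormedSpace ℝ E]
    [NormedAddCommGroup F] [NormedSpace ℝ F] (L : E →L[ℝ] F) {f : ℝ → E} {a b : ℝ}
    (hf : IntervalIntegrable f volume a b) :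
    IntervalIntegrable (fun σ => L (f σ)) volume a b :=
  ⟨L.integrable_comp hf.1, L.integrable_comp hf.2⟩

end Admissible

/-! ## Trajectories -/

section Trajectory

variable {U V : Type*} [NormedAddCommGroup U] [InnerProductSpace ℝ U]
  [NormedAddCommGroup V] [InnerProductSpace ℝ V]
  {S : C0Semigroup (StrongDual ℝ V)} {A : StrongDual ℝ V →ₗ.[ℝ] StrongDual ℝ V}
  {B : U →L[ℝ] StrongDual ℝ V} {ω m : ℝ} {u : ℝ → U}

/-- Restarting at time T with the shifted control follows the same path: the flow property behind
dynamic programming. -/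
theorem trajectory_shift (hS : S.HasGrowth ω)
    (hu : IntegrableOn (fun τ => Real.exp (-(m * τ)) • u τ) (Ioi 0)) (x : StrongDual ℝ V)
    {s T : ℝ} (hs : 0 ≤ s) (hT : 0 ≤ T) :
    trajectory S B 0 (trajectory S B 0 x u T) (fun σ => u (σ + T)) s =
      trajectory S B 0 x u (s + T) := by
  have hB : ∀ {a b : ℝ}, 0 ≤ a → a ≤ b → IntervalIntegrable (fun σ => B (u σ)) volume a b :=
    fun ha hab => intervalIntegrable_clm_comp B (intervalIntegrable_of_exp hu ha hab)
  have hsT := C0Semigroup.intervalIntegrable_convolution hS (add_nonneg hs hT)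
    (hB le_rfl (add_nonneg hs hT))
  have hint := C0Semigroup.intervalIntegrable_convolution hS hT (hB le_rfl hT)
  simp only [trajectory, sub_zero]
  have h1 : ∫ σ in (0 : ℝ)..s, S (s - σ) (B (u (σ + T))) =
      ∫ σ in T..s + T, S (s + T - σ) (B (u σ)) := by
    have := intervalIntegral.integral_comp_add_right (a := 0) (b := s)
      (fun σ => S (s + T - σ) (B (u σ))) T
    simp only [zero_add] at this
    rw [← this]
    refine intervalIntegral.integral_congr fun σ _ => ?_
    congr 2; ring
  have h2 : S s (∫ σ in (0 : ℝ)..T, S (T - σ) (B (u σ))) =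
      ∫ σ in (0 : ℝ)..T, S (s + T - σ) (B (u σ)) := by
    rw [← (S s).intervalIntegral_comp_comm hint]
    refine intervalIntegral.integral_congr fun σ hσ => ?_
    rw [uIcc_of_le hT] at hσ
    rw [← S.apply_add hs (sub_nonneg.2 hσ.2)]
    congr 2; ring
  rw [map_add, h1, h2, ← S.apply_add hs hT, add_assoc, intervalIntegral.integral_add_adjacent_intervals]
  · refine hsT.mono_set ?_
    rw [uIcc_of_le hT, uIcc_of_le (add_nonneg hs hT)]
    exact Icc_subset_Icc_right (by linarith)
  · refine hsT.mono_set ?_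
    rw [uIcc_of_le (by linarith), uIcc_of_le (add_nonneg hs hT)]
    exact Icc_subset_Icc_left hT

theorem trajectory_sub_stationary (hA : IsInfinitesimalGenerator S A) (hS : S.HasGrowth ω)
    {x₀ : A.domain} {u₀ : U} (h₀ : A x₀ + B u₀ = 0)
    (hu : IntegrableOn (fun τ => Real.exp (-(m * τ)) • u τ) (Ioi 0)) (x : StrongDual ℝ V)
    {τ : ℝ} (hτ : 0 ≤ τ) :
    trajectory S B 0 x u τ - x₀ =
      S τ (x - x₀) + ∫ σ in (0 : ℝ)..τ, S (τ - σ) (B (u σ - u₀)) := by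
  have hst := hA.stationary hS x₀ h₀ hτ
  have h1 : IntervalIntegrable (fun σ => S (τ - σ) (B (u σ))) volume 0 τ :=
    C0Semigroup.intervalIntegrable_convolution hS hτ
      (intervalIntegrable_clm_comp B (intervalIntegrable_of_exp hu le_rfl hτ))
  have h2 : IntervalIntegrable (fun σ => S (τ - σ) (B u₀)) volume 0 τ :=
    C0Semigroup.intervalIntegrable_convolution hS hτ intervalIntegrable_const
  have h3 := intervalIntegral.integral_sub h1 h2
  simp only [map_sub]
  rw [h3]
  simp only [trajectory, sub_zero]
  conv_lhs => rw [← hst]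
  abel

theorem integrableOn_exp_smul_const {E : Type*} [NormedAddCommGroup E] [NormedSpace ℝ E]
    (hm : 0 < m) (e : E) : IntegrableOn (fun τ => Real.exp (-(m * τ)) • e) (Ioi 0) := by
  have := (C0Semigroup.integrableOn_exp_neg_mul hm).smul_const e
  simpa only [neg_mul, IntegrableOn] using this

theorem integral_exp_smul_const {E : Type*} [NormedAddCommGroup E] [NormedSpace ℝ E]
    [CompleteSpace E] (hm : 0 < m) (e : E) :
    ∫ τ in Ioi (0 : ℝ), Real.exp (-(m * τ)) • e = m⁻¹ • e := by
  rw [integral_smul_const, ← C0Semigroup.integral_exp_neg_mul hm]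
  simp only [neg_mul]

theorem integrableOn_exp_smul_sub (hm : 0 < m)
    (hu : IntegrableOn (fun τ => Real.exp (-(m * τ)) • u τ) (Ioi 0)) (u₀ : U) :
    IntegrableOn (fun τ => Real.exp (-(m * τ)) • (u τ - u₀)) (Ioi 0) := by
  simp only [smul_sub]
  exact hu.sub (integrableOn_exp_smul_const hm u₀)

theorem trajectory_const_sub (hA : IsInfinitesimalGenerator S A) (hS : S.HasGrowth ω)
    {x₀ : A.domain} {u₀ : U} (hst : A x₀ + B u₀ = 0) (x : StrongDual ℝ V) {τ : ℝ} (hτ : 0 ≤ τ) :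
    trajectory S B 0 x (fun _ => u₀) τ - x₀ = S τ (x - x₀) := by
  rw [trajectory_sub_stationary hA hS hst (integrableOn_exp_smul_const one_pos u₀) x hτ]
  simp

theorem valueZero_le_cost {g₀ : StrongDual ℝ V → ℝ} {h₀ : U → ℝ} {p lam : ℝ}
    (hu : IsAdmissible p lam 0 u) (x : StrongDual ℝ V) :
    valueZero S B g₀ h₀ p lam x ≤ cost S B g₀ h₀ lam 0 x u :=
  iInf_le (fun u : {u : ℝ → U // IsAdmissible p lam 0 u} => cost S B g₀ h₀ lam 0 x u) ⟨u, hu⟩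

theorem cost_const_stationary {g₀ : StrongDual ℝ V → ℝ} {h₀ : U → ℝ} {lam : ℝ}
    (hA : IsInfinitesimalGenerator S A) (hS : S.HasGrowth ω)
    (hlam : 0 < lam) {x₀ : A.domain} {u₀ : U} (hst : A x₀ + B u₀ = 0) :
    cost S B g₀ h₀ lam 0 x₀ (fun _ => u₀) = ((lam⁻¹ * (g₀ x₀ + h₀ u₀) : ℝ) : EReal) := by
  have hcongr : ∀ τ ∈ Ioi (0 : ℝ), Real.exp (-(lam * τ)) *
      (g₀ (trajectory S B 0 x₀ (fun _ => u₀) τ) + h₀ u₀) =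
      Real.exp (-(lam * τ)) • (g₀ x₀ + h₀ u₀) := fun τ hτ => by
    have := trajectory_const_sub hA hS hst x₀ (le_of_lt hτ)
    rw [sub_self, map_zero, sub_eq_zero] at this
    rw [this, smul_eq_mul]
  rw [cost, extendedIntegral_congr hcongr,
    extendedIntegral_eq_integral (integrableOn_exp_smul_const hlam _),
    integral_exp_smul_const hlam, smul_eq_mul]

/-- The value at the state reached at time `T` is at most the rescaled remaining cost. -/
theorem valueZero_trajectory_le {g₀ : StrongDual ℝ V → ℝ} {h₀ : U → ℝ} {p lam : ℝ}
    (hS : S.HasGrowth ω) (hp : 1 < p) (hlam : 0 < lam)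
    (hu : IsAdmissible p lam 0 u) (x : StrongDual ℝ V)
    (hF : IntegrableOn (fun τ => Real.exp (-(lam * τ)) *
      (g₀ (trajectory S B 0 x u τ) + h₀ (u τ))) (Ioi 0)) {T : ℝ} (hT : 0 ≤ T) :
    valueZero S B g₀ h₀ p lam (trajectory S B 0 x u T) ≤
      ((Real.exp (lam * T) * ∫ τ in Ioi T, Real.exp (-(lam * τ)) *
        (g₀ (trajectory S B 0 x u τ) + h₀ (u τ)) : ℝ) : EReal) := by
  refine (valueZero_le_cost (hu.shift (by linarith) hT) _).trans_eq ?_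
  have hexp := hu.integrableOn_exp hp hlam le_rfl
  set F : ℝ → ℝ := fun τ => Real.exp (-(lam * τ)) *
      (g₀ (trajectory S B 0 x u τ) + h₀ (u τ)) with hFdef
  have hcongr : ∀ s ∈ Ioi (0 : ℝ), Real.exp (-(lam * s)) *
      (g₀ (trajectory S B 0 (trajectory S B 0 x u T) (fun σ => u (σ + T)) s) + h₀ (u (s + T))) =
      Real.exp (lam * T) * F (s + T) := fun s hs => by
    rw [trajectory_shift hS hexp x (le_of_lt hs) hT, hFdef]
    simp only
    rw [← mul_assoc, ← Real.exp_add]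
    congr 2; ring
  have hmp := measurePreserving_add_Ioi T
  have hFT : IntegrableOn F (Ioi T) := hF.mono_set (Ioi_subset_Ioi hT)
  have hshift : IntegrableOn (fun s => Real.exp (lam * T) * F (s + T)) (Ioi 0) :=
    (hmp.integrable_comp_of_integrable hFT).const_mul (Real.exp (lam * T))
  rw [cost, extendedIntegral_congr hcongr]
  rw [extendedIntegral_eq_integral hshift, EReal.coe_eq_coe_iff]
  have hI := hmp.integral_comp (measurableEmbedding_addRight T) F
  rw [← hI, ← integral_const_mul]

variable [CompleteSpace U]

/-- The deviation from the stationary state is a free orbit plus a convolution, and the Laplace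
transform turns both into the resolvent. The whole control enters only through its discounted mean
deviation. -/
theorem laplace_trajectory (hA : IsInfinitesimalGenerator S A) (hS : S.HasGrowth ω)
    (hm : 0 < m) (hωm : ω < m) {x₀ : A.domain} {u₀ : U} (h₀ : A x₀ + B u₀ = 0)
    (hu : IntegrableOn (fun τ => Real.exp (-(m * τ)) • u τ) (Ioi 0)) (x : StrongDual ℝ V) :
    IntegrableOn (fun τ => Real.exp (-(m * τ)) • (trajectory S B 0 x u τ - x₀)) (Ioi 0) ∧
    ∫ τ in Ioi (0 : ℝ), Real.exp (-(m * τ)) • (trajectory S B 0 x u τ - x₀) =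
      S.laplace ω m
        (x - x₀ + B (∫ σ in Ioi (0 : ℝ), Real.exp (-(m * σ)) • (u σ - u₀))) := by
  have hw := integrableOn_exp_smul_sub hm hu u₀
  have hBw : IntegrableOn (fun σ => Real.exp (-(m * σ)) • B (u σ - u₀)) (Ioi 0) := by
    refine (B.integrable_comp hw).congr (Eventually.of_forall fun σ => ?_)
    simp only [map_smul]
  have hI := C0Semigroup.laplace_integrable hS hωm (x - x₀)
  have hC := C0Semigroup.integrableOn_laplace_convolution hS hωm hBw
  have heq : ∀ τ ∈ Ioi (0 : ℝ), Real.exp (-(m * τ)) • (trajectory S B 0 x u τ - x₀) =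
      Real.exp (-(m * τ)) • S τ (x - x₀) +
        Real.exp (-(m * τ)) • ∫ σ in (0 : ℝ)..τ, S (τ - σ) (B (u σ - u₀)) := fun τ hτ => by
    rw [trajectory_sub_stationary hA hS h₀ hu x (le_of_lt hτ), smul_add]
  constructor
  · exact IntegrableOn.congr_fun (hI.add hC) (fun τ hτ => (heq τ hτ).symm) measurableSet_Ioi
  · rw [setIntegral_congr_fun measurableSet_Ioi heq, integral_add hI hC,
      C0Semigroup.laplace_convolution hS hωm hBw, ← C0Semigroup.laplace_apply hS hωm, map_add,
      ← B.integral_comp_comm hw]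
    simp only [map_smul]

/-- Integrates the affine minorant of the running cost. The case θ = 0 serves the sufficiency
argument; the θ term is the reserve that absorbs the error in the averaged dynamic programming. -/
theorem integral_affine_bound (hA : IsInfinitesimalGenerator S A) (hS : S.HasGrowth ω)
    (hm : 0 < m) (hωm : ω < m) {x₀ : A.domain} {u₀ : U} (hst : A x₀ + B u₀ = 0)
    (hu : IntegrableOn (fun τ => Real.exp (-(m * τ)) • u τ) (Ioi 0)) (x : StrongDual ℝ V)
    (q v : V) (c θ C : ℝ) :
    IntegrableOn (fun τ => Real.exp (-(m * τ)) * (c + (trajectory S B 0 x u τ - x₀) q -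
      B (u τ - u₀) v + θ * (‖u τ - u₀‖ - C))) (Ioi 0) ∧
    ∫ τ in Ioi (0 : ℝ), Real.exp (-(m * τ)) * (c + (trajectory S B 0 x u τ - x₀) q -
      B (u τ - u₀) v + θ * (‖u τ - u₀‖ - C)) =
      m⁻¹ * (c - θ * C) + S.laplace ω m
        (x - x₀ + B (∫ σ in Ioi (0 : ℝ), Real.exp (-(m * σ)) • (u σ - u₀))) q -
      B (∫ σ in Ioi (0 : ℝ), Real.exp (-(m * σ)) • (u σ - u₀)) v +
      θ * ∫ σ in Ioi (0 : ℝ), ‖Real.exp (-(m * σ)) • (u σ - u₀)‖ := by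
  have hw := integrableOn_exp_smul_sub hm hu u₀
  obtain ⟨hy, hyI⟩ := laplace_trajectory hA hS hm hωm hst hu x
  have i1 := integrableOn_exp_smul_const hm (c - θ * C)
  have i2 := (ContinuousLinearMap.apply ℝ ℝ q).integrable_comp hy
  have i3 := (B.flip v).integrable_comp hw
  have i4 := hw.norm.const_mul θ
  have heq : (fun τ => Real.exp (-(m * τ)) * (c + (trajectory S B 0 x u τ - x₀) q -
      B (u τ - u₀) v + θ * (‖u τ - u₀‖ - C))) = fun τ =>
      Real.exp (-(m * τ)) • (c - θ * C) + ContinuousLinearMap.apply ℝ ℝ q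
        (Real.exp (-(m * τ)) • (trajectory S B 0 x u τ - x₀)) -
      B.flip v (Real.exp (-(m * τ)) • (u τ - u₀)) +
      θ * ‖Real.exp (-(m * τ)) • (u τ - u₀)‖ := by
    ext τ
    rw [norm_smul, Real.norm_eq_abs, Real.abs_exp, map_smul, map_smul]
    simp only [ContinuousLinearMap.apply_apply, ContinuousLinearMap.flip_apply, smul_eq_mul]
    ring
  rw [heq]
  refine ⟨((i1.add i2).sub i3).add i4, ?_⟩
  refine (integral_add ((i1.add i2).sub i3) i4).trans ?_
  rw [integral_sub' (i1.add i2) i3, integral_add' i1 i2,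
    integral_exp_smul_const hm, (ContinuousLinearMap.apply ℝ ℝ q).integral_comp_comm hy,
    (B.flip v).integral_comp_comm hw, integral_const_mul, hyI]
  simp only [ContinuousLinearMap.apply_apply, ContinuousLinearMap.flip_apply, smul_eq_mul]

end Trajectory

/-! ## Cost estimates around a stationary pair -/

section Cost

variable {U V : Type*} [NormedAddCommGroup U] [InnerProductSpace ℝ U] [CompleteSpace U]
  [NormedAddCommGroup V] [InnerProductSpace ℝ V] [CompleteSpace V]
  {S : C0Semigroup (StrongDual ℝ V)} {A : StrongDual ℝ V →ₗ.[ℝ] StrongDual ℝ V}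
  {B : U →L[ℝ] StrongDual ℝ V} {g₀ : StrongDual ℝ V → ℝ} {h₀ : U → ℝ} {p lam ω m : ℝ} {u : ℝ → U}

theorem apply_dualGradient (f : StrongDual ℝ V → ℝ) (x y : StrongDual ℝ V) :
    y (dualGradient f x) = fderiv ℝ f x y :=
  apply_bidualToPrimal _ _

namespace StandingAssumptions

theorem hasGrowth (hdata : StandingAssumptions S A g₀ h₀ p lam ω) : S.HasGrowth ω := hdata.growth

theorem isSuperlinear (hdata : StandingAssumptions S A g₀ h₀ p lam ω) : IsSuperlinear h₀ := by
  obtain ⟨hp, a, b, ha, hab⟩ := hdata.coercive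
  exact isSuperlinear_of_rpow_le ha hp hab

theorem add_apply_dualGradient_le (hdata : StandingAssumptions S A g₀ h₀ p lam ω)
    (x y : StrongDual ℝ V) : g₀ x + (y - x) (dualGradient g₀ x) ≤ g₀ y := by
  rw [apply_dualGradient]
  exact hdata.g₀_sigma.1.add_fderiv_le (hdata.g₀_sigma.2.1 x) y

theorem feedback_sub_le (hdata : StandingAssumptions S A g₀ h₀ p lam ω)
    (B : U →L[ℝ] StrongDual ℝ V) (v : V) (u : U) :
    h₀ (feedback B h₀ v) - B (u - feedback B h₀ v) v ≤ h₀ u := by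
  have h := mem_subdiff_gradient_convexConj hdata.h₀_convex hdata.h₀_lsc hdata.isSuperlinear
    hdata.conj_sigma (-controlAdjoint B v) u
  rw [inner_neg_left, inner_controlAdjoint] at h
  change -(B (u - feedback B h₀ v)) v ≤ h₀ u - h₀ (feedback B h₀ v) at h
  linarith

/-- Interpolation between the subgradient inequality and superlinear growth. -/
theorem exists_feedback_sub_add_le (hdata : StandingAssumptions S A g₀ h₀ p lam ω)
    (B : U →L[ℝ] StrongDual ℝ V) (v : V) :
    ∃ C : ℝ, ∀ θ ∈ Icc (0 : ℝ) 1, ∀ u : U,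
      h₀ (feedback B h₀ v) - B (u - feedback B h₀ v) v + θ * (‖u - feedback B h₀ v‖ - C) ≤ h₀ u := by
  set u₀ := feedback B h₀ v with hu₀
  set b := ‖controlAdjoint B v‖
  obtain ⟨D, hD⟩ := hdata.isSuperlinear (1 + b)
  refine ⟨D + h₀ u₀ + (b + 1) * ‖u₀‖, fun θ hθ u => ?_⟩
  have h1 := hdata.feedback_sub_le B v u
  rw [← hu₀] at h1
  -- The case θ = 1, for which the constant was chosen: after the triangle inequality the left side
  -- is at most (1 + b)‖u‖ - D. Other θ are convex combinations with the subgradient inequality, the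
  -- case θ = 0.
  have h2 : h₀ u₀ - B (u - u₀) v + (‖u - u₀‖ - (D + h₀ u₀ + (b + 1) * ‖u₀‖)) ≤ h₀ u := by
    have h3 := hD u
    have h4 : -(B (u - u₀) v) ≤ b * ‖u - u₀‖ := by
      rw [← inner_controlAdjoint, ← inner_neg_left]
      exact (real_inner_le_norm _ _).trans_eq (by rw [norm_neg])
    have h5 := _root_.norm_sub_le u u₀
    have h6 : 0 ≤ b := norm_nonneg _
    have := mul_le_mul_of_nonneg_left h5 h6
    linarith
  have h3 := mul_le_mul_of_nonneg_left h1 (sub_nonneg.2 hθ.2)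
  have h4 := mul_le_mul_of_nonneg_left h2 hθ.1
  linarith

end StandingAssumptions

theorem le_running_cost (hdata : StandingAssumptions S A g₀ h₀ p lam ω) (x : StrongDual ℝ V)
    (x₀ : StrongDual ℝ V) {u₀ : U} {v : V} {θ C : ℝ}
    (hh : ∀ u : U, h₀ u₀ - B (u - u₀) v + θ * (‖u - u₀‖ - C) ≤ h₀ u) (τ : ℝ) :
    Real.exp (-(m * τ)) * (g₀ x₀ + h₀ u₀ + (trajectory S B 0 x u τ - x₀) (dualGradient g₀ x₀) -
      B (u τ - u₀) v + θ * (‖u τ - u₀‖ - C)) ≤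
    Real.exp (-(m * τ)) * (g₀ (trajectory S B 0 x u τ) + h₀ (u τ)) := by
  refine mul_le_mul_of_nonneg_left ?_ (Real.exp_pos _).le
  have h1 := hdata.add_apply_dualGradient_le x₀ (trajectory S B 0 x u τ)
  have h2 := hh (u τ)
  linarith

/-- The cost of any control is bounded below by the affine function whose slope is the stationary
costate. -/
theorem le_cost (hdata : StandingAssumptions S A g₀ h₀ p lam ω) (hlam : 0 < lam)
    {x₀ : A.domain} {π : V}
    (hπ : π = primalAdjoint (S.laplace ω lam) (dualGradient g₀ x₀))
    (hst : A x₀ + B (feedback B h₀ π) = 0) (x : StrongDual ℝ V) (hu : IsAdmissible p lam 0 u) :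
    ((lam⁻¹ * (g₀ x₀ + h₀ (feedback B h₀ π)) + (x - x₀) π : ℝ) : EReal) ≤
      cost S B g₀ h₀ lam 0 x u := by
  have hexp := hu.integrableOn_exp hdata.coercive.1 hlam le_rfl
  obtain ⟨hint, hval⟩ := integral_affine_bound hdata.generator hdata.hasGrowth hlam hdata.discount
    hst hexp x (dualGradient g₀ x₀) π (g₀ x₀ + h₀ (feedback B h₀ π)) 0 0
  have hle : ∀ τ ∈ Ioi (0 : ℝ), _ ≤ _ := fun τ _ =>
    le_running_cost (B := B) (u := u) (m := lam) (θ := 0) (C := 0) hdata x x₀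
      (fun w => by simpa using hdata.feedback_sub_le B π w) τ
  refine le_trans ?_ (extendedIntegral_mono hle)
  -- Moving the resolvent onto the gradient of `g₀` produces π, so the state contribution of the
  -- control cancels the control term exactly.
  rw [extendedIntegral_eq_integral hint, hval, EReal.coe_le_coe_iff, ← apply_primalAdjoint, ← hπ]
  simp only [_root_.add_apply, zero_mul, add_zero, sub_zero]
  linarith

/-- Second order upper bound for the cost of the stationary control at nearby states. -/
theorem cost_const_le (hdata : StandingAssumptions S A g₀ h₀ p lam ω) (hlam : 0 < lam)
    (hlam2 : 2 * ω < lam) {K : NNReal} (hK : LipschitzWith K (fderiv ℝ g₀))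
    {x₀ : A.domain} {u₀ : U} (hst : A x₀ + B u₀ = 0) (x : StrongDual ℝ V) :
    cost S B g₀ h₀ lam 0 x (fun _ => u₀) ≤
      ((lam⁻¹ * (g₀ x₀ + h₀ u₀) +
        (x - x₀) (primalAdjoint (S.laplace ω lam) (dualGradient g₀ x₀)) +
        (lam - 2 * ω)⁻¹ * (K * ‖x - x₀‖ ^ 2) : ℝ) : EReal) := by
  have hS := hdata.hasGrowth
  set q := dualGradient g₀ x₀ with hq
  have i1 := integrableOn_exp_smul_const hlam (g₀ x₀ + h₀ u₀)
  have hl := C0Semigroup.laplace_integrable hS hdata.discount (x - x₀)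
  have i2 := (ContinuousLinearMap.apply ℝ ℝ q).integrable_comp hl
  have i3 := (C0Semigroup.integrableOn_exp_neg_mul (sub_pos.2 hlam2)).mul_const
    (K * ‖x - x₀‖ ^ 2)
  have hle : ∀ τ ∈ Ioi (0 : ℝ), Real.exp (-(lam * τ)) *
      (g₀ (trajectory S B 0 x (fun _ => u₀) τ) + h₀ u₀) ≤
      Real.exp (-(lam * τ)) • (g₀ x₀ + h₀ u₀) +
        ContinuousLinearMap.apply ℝ ℝ q (Real.exp (-(lam * τ)) • S τ (x - x₀)) +
        Real.exp (-(lam - 2 * ω) * τ) * (K * ‖x - x₀‖ ^ 2) := by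
    intro τ hτ
    have hτ0 : 0 ≤ τ := le_of_lt hτ
    have htr := trajectory_const_sub hdata.generator hS hst x hτ0
    have h1 := hdata.g₀_sigma.1.le_add_fderiv_add_sq hdata.g₀_sigma.2.1 hK x₀
      (trajectory S B 0 x (fun _ => u₀) τ)
    rw [htr, ← apply_dualGradient, ← hq] at h1
    -- The squared deviation grows like e^{2ωτ}; this is where λ > 2ω is needed.
    have h2 : Real.exp (-(lam * τ)) * ‖S τ (x - x₀)‖ ^ 2 ≤
        Real.exp (-(lam - 2 * ω) * τ) * ‖x - x₀‖ ^ 2 := by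
      calc _ ≤ Real.exp (-(lam * τ)) * (Real.exp (ω * τ) * ‖x - x₀‖) ^ 2 := by
            gcongr; exact hS τ hτ0 _
        _ = _ := by
            rw [mul_pow, ← Real.exp_nat_mul, ← mul_assoc, ← Real.exp_add]
            congr 2; push_cast; ring
    have h3 := mul_le_mul_of_nonneg_left h1 (Real.exp_pos (-(lam * τ))).le
    have h4 := mul_le_mul_of_nonneg_left h2 K.coe_nonneg
    simp only [map_smul, ContinuousLinearMap.apply_apply, smul_eq_mul]
    linarith
  refine (extendedIntegral_mono hle).trans ?_
  refine (extendedIntegral_eq_integral ((i1.add i2).add i3)).trans_le ?_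
  rw [EReal.coe_le_coe_iff, integral_add' (i1.add i2) i3, integral_add' i1 i2, integral_exp_smul_const hlam,
    (ContinuousLinearMap.apply ℝ ℝ q).integral_comp_comm hl,
    ← C0Semigroup.laplace_apply hS hdata.discount, integral_mul_const,
    C0Semigroup.integral_exp_neg_mul (sub_pos.2 hlam2), ContinuousLinearMap.apply_apply,
    apply_primalAdjoint, smul_eq_mul]

end Cost

/-! ## The value function at closed loop equilibria -/

/-- The weight μe^{-μT} has mass e^{-μt} beyond t. Fubini is obtained by reading the left integrand
as the convolution of e^{-μt}F(t) with the probability density μe^{-μt}. -/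
theorem exponential_average {F : ℝ → ℝ} (hF : IntegrableOn F (Ioi 0)) {μ : ℝ} (hμ : 0 < μ) :
    IntegrableOn (fun T => μ * Real.exp (-(μ * T)) * ∫ t in (0 : ℝ)..T, F t) (Ioi 0) ∧
    ∫ T in Ioi (0 : ℝ), μ * Real.exp (-(μ * T)) * ∫ t in (0 : ℝ)..T, F t =
      ∫ t in Ioi (0 : ℝ), Real.exp (-(μ * t)) * F t := by
  have hf : IntegrableOn (fun t => Real.exp (-(μ * t)) * F t) (Ioi 0) := by
    refine Integrable.mono' hF.norm
      (AEStronglyMeasurable.mul (by fun_prop) hF.aestronglyMeasurable) ?_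
    filter_upwards [ae_restrict_mem measurableSet_Ioi] with t ht
    have ht0 : 0 < t := ht
    rw [norm_mul, Real.norm_eq_abs (Real.exp _), Real.abs_exp]
    refine mul_le_of_le_one_left (norm_nonneg _) (Real.exp_le_one_iff.2 ?_)
    nlinarith
  have hg : IntegrableOn (fun t => μ * Real.exp (-(μ * t))) (Ioi 0) := by
    have := (C0Semigroup.integrableOn_exp_neg_mul hμ).const_mul μ
    simpa only [neg_mul, IntegrableOn] using this
  have hgI : ∫ t in Ioi (0 : ℝ), μ * Real.exp (-(μ * t)) = 1 := by
    have := C0Semigroup.integral_exp_neg_mul hμ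
    simp only [neg_mul] at this
    rw [integral_const_mul, this, mul_inv_cancel₀ hμ.ne']
  have heq : ∀ T : ℝ, ∫ t in (0 : ℝ)..T, ContinuousLinearMap.mul ℝ ℝ (Real.exp (-(μ * t)) * F t)
      (μ * Real.exp (-(μ * (T - t)))) = μ * Real.exp (-(μ * T)) * ∫ t in (0 : ℝ)..T, F t := by
    intro T
    rw [← intervalIntegral.integral_const_mul]
    refine intervalIntegral.integral_congr fun t _ => ?_
    simp only [ContinuousLinearMap.mul_apply']
    rw [show -(μ * T) = -(μ * t) + -(μ * (T - t)) by ring, Real.exp_add]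
    ring
  constructor
  · have := integrable_posConvolution (μ := volume) (ν := volume) hf hg
      (ContinuousLinearMap.mul ℝ ℝ)
    rw [posConvolution, integrable_indicator_iff measurableSet_Ioi] at this
    simpa only [heq] using this
  · have := integral_posConvolution (μ := volume) (ν := volume) hf hg
      (ContinuousLinearMap.mul ℝ ℝ)
    simp only [heq, hgI] at this
    simpa only [ContinuousLinearMap.mul_apply', mul_one] using this

/-- Test with the functional represented by t(v - w), divide by t, and let t → 0+. -/
theorem eq_of_dual_sub_le_sq {V : Type*} [NormedAddCommGroup V] [InnerProductSpace ℝ V]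
    {v w : V} {K : ℝ}
    (h : ∀ ξ : StrongDual ℝ V, ξ v ≤ ξ w + K * ‖ξ‖ ^ 2) :
    v = w := by
  rw [← sub_eq_zero]
  set d := v - w with hd
  have hpos : ∀ t : ℝ, 0 < t → ‖d‖ ^ 2 ≤ t * (K * ‖d‖ ^ 2) := by
    intro t ht
    have h1 := h (innerSL ℝ (t • d))
    rw [innerSL_apply_norm, innerSL_apply_apply, innerSL_apply_apply, norm_smul,
      Real.norm_of_nonneg ht.le] at h1
    have h2 : ⟪t • d, v⟫ - ⟪t • d, w⟫ = t * ‖d‖ ^ 2 := by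
      rw [← inner_sub_right, ← hd, real_inner_smul_left, real_inner_self_eq_norm_sq]
    refine le_of_mul_le_mul_left ?_ ht
    linarith
  have hlim : Tendsto (fun t : ℝ => t * (K * ‖d‖ ^ 2)) (𝓝[>] 0) (𝓝 0) := by
    have : Continuous fun t : ℝ => t * (K * ‖d‖ ^ 2) := by fun_prop
    simpa using (this.tendsto 0).mono_left nhdsWithin_le_nhds
  have h0 : ‖d‖ ^ 2 ≤ 0 := ge_of_tendsto hlim (by
    filter_upwards [self_mem_nhdsWithin] with t ht using hpos t ht)
  have : ‖d‖ = 0 := by nlinarith [norm_nonneg d]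
  exact norm_eq_zero.1 this

theorem aestronglyMeasurable_of_exp_smul {E : Type*} [NormedAddCommGroup E] [NormedSpace ℝ E]
    {f : ℝ → E} {m : ℝ} {ν : Measure ℝ}
    (hf : AEStronglyMeasurable (fun τ => Real.exp (-(m * τ)) • f τ) ν) :
    AEStronglyMeasurable f ν := by
  have h : AEStronglyMeasurable (fun τ => Real.exp (m * τ) • Real.exp (-(m * τ)) • f τ) ν :=
    AEStronglyMeasurable.smul (by fun_prop) hf
  refine h.congr (Eventually.of_forall fun τ => ?_)
  simp only [smul_smul, ← Real.exp_add]
  simp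

section Value

variable {U V : Type*} [NormedAddCommGroup U] [InnerProductSpace ℝ U] [CompleteSpace U]
  [NormedAddCommGroup V] [InnerProductSpace ℝ V] [CompleteSpace V]
  {S : C0Semigroup (StrongDual ℝ V)} {A : StrongDual ℝ V →ₗ.[ℝ] StrongDual ℝ V}
  {B : U →L[ℝ] StrongDual ℝ V} {g₀ : StrongDual ℝ V → ℝ} {h₀ : U → ℝ} {p lam ω m : ℝ} {u : ℝ → U}

theorem integrableOn_running_cost (hdata : StandingAssumptions S A g₀ h₀ p lam ω) (hlam : 0 < lam)
    {x₀ : A.domain} {v : V} (hst : A x₀ + B (feedback B h₀ v) = 0)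
    (hu : IsAdmissible p lam 0 u) (x : StrongDual ℝ V) (htop : cost S B g₀ h₀ lam 0 x u ≠ ⊤) :
    IntegrableOn (fun τ => Real.exp (-(lam * τ)) *
      (g₀ (trajectory S B 0 x u τ) + h₀ (u τ))) (Ioi 0) := by
  have hexp := hu.integrableOn_exp hdata.coercive.1 hlam le_rfl
  obtain ⟨hy, -⟩ := laplace_trajectory hdata.generator hdata.hasGrowth hlam hdata.discount
    hst hexp x
  obtain ⟨hint, -⟩ := integral_affine_bound hdata.generator hdata.hasGrowth hlam hdata.discount
    hst hexp x (dualGradient g₀ x₀) v (g₀ x₀ + h₀ (feedback B h₀ v)) 0 0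
  have hsub : ∀ w : U, h₀ (feedback B h₀ v) - B (w - feedback B h₀ v) v +
      0 * (‖w - feedback B h₀ v‖ - 0) ≤ h₀ w := fun w => by
    rw [zero_mul, add_zero]; exact hdata.feedback_sub_le B v w
  have hle := le_running_cost (m := lam) (u := u) hdata x x₀ hsub
  have hym : AEStronglyMeasurable (fun τ => trajectory S B 0 x u τ) (volume.restrict (Ioi 0)) := by
    simpa using (aestronglyMeasurable_of_exp_smul hy.aestronglyMeasurable).add_const
      (x₀ : StrongDual ℝ V)
  have hhm : AEStronglyMeasurable (fun τ => h₀ (u τ)) (volume.restrict (Ioi 0)) := by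
    borelize U
    exact (hdata.h₀_lsc.measurable.comp_aemeasurable
      hu.aestronglyMeasurable.aemeasurable).aestronglyMeasurable
  refine integrableOn_of_extendedIntegral_ne_top ?_ hint (fun τ _ => hle τ) htop
  exact AEStronglyMeasurable.mul (by fun_prop)
    ((hdata.g₀_sigma.2.1.continuous.comp_aestronglyMeasurable hym).add hhm)

/-- Exponentially averaged dynamic programming inequality at a closed loop equilibrium. -/
theorem averaged_dynamic_programming (hdata : StandingAssumptions S A g₀ h₀ p lam ω)
    (hlam : 0 < lam) {Z₀ : StrongDual ℝ V → ℝ}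
    (hZ : ∀ x, valueZero S B g₀ h₀ p lam x = ((Z₀ x : ℝ) : EReal)) {x₀ : A.domain} {v : V}
    (hv : ∀ y : StrongDual ℝ V, Z₀ x₀ + (y - x₀) v ≤ Z₀ y) (hst : A x₀ + B (feedback B h₀ v) = 0) {θ C : ℝ}
    (hC : ∀ u : U, h₀ (feedback B h₀ v) - B (u - feedback B h₀ v) v +
      θ * (‖u - feedback B h₀ v‖ - C) ≤ h₀ u) (hm : lam < m)
    (hθ : ‖B‖ * ‖primalAdjoint (S.laplace ω m) (dualGradient g₀ x₀) +
      (m - lam) • primalAdjoint (S.laplace ω m) v - v‖ ≤ θ)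
    (hu : IsAdmissible p lam 0 u)
    (hF : IntegrableOn (fun τ => Real.exp (-(lam * τ)) *
      (g₀ (trajectory S B 0 x₀ u τ) + h₀ (u τ))) (Ioi 0)) :
    m⁻¹ * (g₀ x₀ + h₀ (feedback B h₀ v) + (m - lam) * Z₀ x₀ - θ * C) ≤
      ∫ τ in Ioi (0 : ℝ), Real.exp (-(lam * τ)) *
        (g₀ (trajectory S B 0 x₀ u τ) + h₀ (u τ)) := by
  have hS := hdata.hasGrowth
  have hp := hdata.coercive.1
  have hm0 : 0 < m := hlam.trans hm
  have hωm : ω < m := hdata.discount.trans hm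
  have hμ : 0 < m - lam := sub_pos.2 hm
  have hexp := hu.integrableOn_exp hp hlam hm.le
  set u₀ := feedback B h₀ v
  set q := dualGradient g₀ x₀
  set F : ℝ → ℝ := fun τ => Real.exp (-(lam * τ)) *
    (g₀ (trajectory S B 0 x₀ u τ) + h₀ (u τ)) with hFdef
  set w := ∫ σ in Ioi (0 : ℝ), Real.exp (-(m * σ)) • (u σ - u₀)
  obtain ⟨hy, hyI⟩ := laplace_trajectory hdata.generator hS hm0 hωm hst hexp x₀
  obtain ⟨ha, haI⟩ := exponential_average hF hμ
  have hmulexp : ∀ t : ℝ, Real.exp (-((m - lam) * t)) * Real.exp (-(lam * t)) =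
      Real.exp (-(m * t)) := fun t => by rw [← Real.exp_add]; congr 1; ring
  -- The remaining cost after T dominates the discounted value at the state reached, which the
  -- subgradient v bounds below.
  have hdpp : ∀ T ∈ Ioi (0 : ℝ),
      (∫ t in (0 : ℝ)..T, F t) + Real.exp (-(lam * T)) *
        (Z₀ x₀ + (trajectory S B 0 x₀ u T - x₀) v) ≤ ∫ t in Ioi (0 : ℝ), F t := by
    intro T hT
    have hT0 : 0 ≤ T := le_of_lt hT
    have h1 := valueZero_trajectory_le hS hp hlam hu x₀ hF hT0
    rw [hZ, EReal.coe_le_coe_iff] at h1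
    have h2 := mul_le_mul_of_nonneg_left ((hv _).trans h1) (Real.exp_pos (-(lam * T))).le
    rw [← mul_assoc, ← Real.exp_add, neg_add_cancel, Real.exp_zero, one_mul] at h2
    have h3 : ∫ t in Ioi (0 : ℝ), F t = (∫ t in (0 : ℝ)..T, F t) + ∫ t in Ioi T, F t := by
      rw [intervalIntegral.integral_of_le hT0, ← Ioc_union_Ioi_eq_Ioi hT0,
        setIntegral_union (Ioc_disjoint_Ioi le_rfl) measurableSet_Ioi
        (hF.mono_set Ioc_subset_Ioi_self) (hF.mono_set (Ioi_subset_Ioi hT0))]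
    rw [h3]
    linarith
  have i1 := integrableOn_exp_smul_const hm0 ((m - lam) * Z₀ x₀)
  have i2 := ((ContinuousLinearMap.apply ℝ ℝ v).integrable_comp hy).const_mul (m - lam)
  have i3 := integrableOn_exp_smul_const hμ ((m - lam) * ∫ t in Ioi (0 : ℝ), F t)
  -- Averaging with rate m - λ raises every discount from λ to m, so the Laplace formulas at m
  -- apply.
  have havg := setIntegral_mono_on ((ha.add i1).add i2) i3 measurableSet_Ioi (fun T hT => by
    have h1 := mul_le_mul_of_nonneg_left (hdpp T hT)
      (mul_pos hμ (Real.exp_pos (-((m - lam) * T)))).le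
    have h2 := hmulexp T
    simp only [Pi.add_apply, map_smul, ContinuousLinearMap.apply_apply, smul_eq_mul]
    rw [← h2]
    linarith)
  rw [integral_add' (ha.add i1) i2, integral_add' ha i1, haI, integral_exp_smul_const hm0,
    integral_exp_smul_const hμ, integral_const_mul,
    (ContinuousLinearMap.apply ℝ ℝ v).integral_comp_comm hy, hyI,
    ContinuousLinearMap.apply_apply, smul_eq_mul, smul_eq_mul, inv_mul_cancel_left₀ hμ.ne',
    sub_self, zero_add] at havg
  obtain ⟨hl, hlI⟩ := integral_affine_bound hdata.generator hS hm0 hωm hst hexp x₀ q v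
    (g₀ x₀ + h₀ u₀) θ C
  have heF : (fun t => Real.exp (-((m - lam) * t)) * F t) = fun t => Real.exp (-(m * t)) *
      (g₀ (trajectory S B 0 x₀ u t) + h₀ (u t)) := by
    ext t
    rw [hFdef, ← hmulexp t, mul_assoc]
  have hFm : IntegrableOn (fun t => Real.exp (-(m * t)) *
      (g₀ (trajectory S B 0 x₀ u t) + h₀ (u t))) (Ioi 0) := by
    rw [← heF]
    refine Integrable.mono' hF.norm
      (AEStronglyMeasurable.mul (by fun_prop) hF.aestronglyMeasurable) ?_
    filter_upwards [ae_restrict_mem measurableSet_Ioi] with t ht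
    have ht0 : 0 < t := ht
    rw [norm_mul, Real.norm_eq_abs (Real.exp _), Real.abs_exp]
    refine mul_le_of_le_one_left (norm_nonneg _) (Real.exp_le_one_iff.2 ?_)
    nlinarith
  have hlow := setIntegral_mono_on hl hFm measurableSet_Ioi
    (fun t _ => le_running_cost hdata x₀ x₀ hC t)
  rw [hlI, sub_self, zero_add] at hlow
  rw [heF] at havg
  have hw : ‖w‖ ≤ ∫ σ in Ioi (0 : ℝ), ‖Real.exp (-(m * σ)) • (u σ - u₀)‖ :=
    norm_integral_le_integral_norm _
  set ρ := ∫ σ in Ioi (0 : ℝ), ‖Real.exp (-(m * σ)) • (u σ - u₀)‖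
  set e := primalAdjoint (S.laplace ω m) q + (m - lam) • primalAdjoint (S.laplace ω m) v - v
    with he
  have hBe : B w e = S.laplace ω m (B w) q + (m - lam) * S.laplace ω m (B w) v - B w v := by
    rw [he, map_sub, map_add, map_smul, apply_primalAdjoint, apply_primalAdjoint, smul_eq_mul]
  have hρ : 0 ≤ ρ := (norm_nonneg w).trans hw
  -- The error is linear in w, and the reserve θρ from the improved lower bound covers it whatever
  -- the size of the control.
  have hBe' : -(θ * ρ) ≤ B w e := by
    have : |B w e| ≤ θ * ρ := by
      calc |B w e| ≤ ‖B w‖ * ‖e‖ := (B w).le_opNorm e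
        _ ≤ ‖B‖ * ‖w‖ * ‖e‖ := by gcongr; exact B.le_opNorm w
        _ = ‖B‖ * ‖e‖ * ‖w‖ := by ring
        _ ≤ θ * ρ := mul_le_mul hθ hw (norm_nonneg _) (le_trans (by positivity) hθ)
    exact (abs_le.1 this).1
  linarith

/-- Supersolution inequality of the Hamilton-Jacobi-Bellman equation at an equilibrium. -/
theorem running_cost_le_mul_value (hdata : StandingAssumptions S A g₀ h₀ p lam ω)
    (hlam : 0 < lam) {Z₀ : StrongDual ℝ V → ℝ}
    (hZ : ∀ x, valueZero S B g₀ h₀ p lam x = ((Z₀ x : ℝ) : EReal)) {x₀ : A.domain} {v : V}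
    (hv : ∀ y : StrongDual ℝ V, Z₀ x₀ + (y - x₀) v ≤ Z₀ y) (hst : A x₀ + B (feedback B h₀ v) = 0) :
    g₀ x₀ + h₀ (feedback B h₀ v) ≤ lam * Z₀ x₀ := by
  have hS := hdata.hasGrowth
  obtain ⟨C, hC⟩ := hdata.exists_feedback_sub_add_le B v
  set θ : ℝ → ℝ := fun m => ‖B‖ * ‖primalAdjoint (S.laplace ω m) (dualGradient g₀ x₀) +
      (m - lam) • primalAdjoint (S.laplace ω m) v - v‖ with hθ
  have hlim : Tendsto θ atTop (𝓝 0) := by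
    have h1 := tendsto_primalAdjoint_laplace hS (dualGradient g₀ x₀)
    have h2 := tendsto_smul_primalAdjoint_laplace hdata.generator hS v
    have h3 := (tendsto_primalAdjoint_laplace hS v).const_smul lam
    have h4 := (((h1.add (h2.sub h3)).sub_const v).norm).const_mul ‖B‖
    simp only [smul_zero, sub_zero, zero_add, sub_self, norm_zero, mul_zero] at h4
    refine h4.congr fun m => ?_
    simp only [hθ, sub_smul]
  have hlim' : Tendsto (fun m => g₀ x₀ + h₀ (feedback B h₀ v) - θ m * C) atTop
      (𝓝 (g₀ x₀ + h₀ (feedback B h₀ v))) := by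
    simpa using (hlim.mul_const C).const_sub (g₀ x₀ + h₀ (feedback B h₀ v))
  refine le_of_tendsto hlim' ?_
  filter_upwards [eventually_gt_atTop lam, hlim.eventually_le_const one_pos] with m hm hθ1
  have hm0 : 0 < m := hlam.trans hm
  have hθ0 : 0 ≤ θ m := by positivity
  -- The bound does not depend on the control, so it passes to the infimum. Multiplying by m cancels
  -- m Z₀(x₀) and leaves g₀ + h₀ - θ(m)C ≤ λ Z₀(x₀).
  have hval : ((m⁻¹ * (g₀ x₀ + h₀ (feedback B h₀ v) + (m - lam) * Z₀ x₀ - θ m * C) : ℝ) : EReal) ≤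
      valueZero S B g₀ h₀ p lam x₀ := by
    refine le_iInf fun ⟨u, hu⟩ => ?_
    by_cases htop : cost S B g₀ h₀ lam 0 x₀ u = ⊤
    · rw [htop]; exact le_top
    · have hF := integrableOn_running_cost hdata hlam hst hu x₀ htop
      rw [cost, extendedIntegral_eq_integral hF, EReal.coe_le_coe_iff]
      exact averaged_dynamic_programming hdata hlam hZ hv hst (hC (θ m) ⟨hθ0, hθ1⟩) hm le_rfl hu hF
  rw [hZ, EReal.coe_le_coe_iff, inv_mul_le_iff₀ hm0] at hval
  linarith

/-- Every subgradient of the value function realizing a closed loop equilibrium is the stationary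
costate. -/
theorem subgradient_eq_costate (hdata : StandingAssumptions S A g₀ h₀ p lam ω)
    (hlam : 0 < lam) (hlam2 : 2 * ω < lam) {Z₀ : StrongDual ℝ V → ℝ}
    (hZ : ∀ x, valueZero S B g₀ h₀ p lam x = ((Z₀ x : ℝ) : EReal)) {x₀ : A.domain} {v : V}
    (hv : ∀ y : StrongDual ℝ V, Z₀ x₀ + (y - x₀) v ≤ Z₀ y) (hst : A x₀ + B (feedback B h₀ v) = 0) :
    v = primalAdjoint (S.laplace ω lam) (dualGradient g₀ x₀) := by
  have hp : 0 < p := by linarith [hdata.coercive.1]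
  obtain ⟨K, hK⟩ := hdata.g₀_sigma.2.2
  refine eq_of_dual_sub_le_sq (K := (lam - 2 * ω)⁻¹ * K) fun ξ => ?_
  have h1 := (valueZero_le_cost (isAdmissible_const hp hlam
    (feedback B h₀ v)) ((x₀ : StrongDual ℝ V) + ξ)).trans (cost_const_le hdata hlam hlam2 hK hst ((x₀ : StrongDual ℝ V) + ξ))
  rw [hZ, EReal.coe_le_coe_iff, add_sub_cancel_left] at h1
  have h2 := hv ((x₀ : StrongDual ℝ V) + ξ)
  rw [add_sub_cancel_left] at h2
  have h3 := running_cost_le_mul_value hdata hlam hZ hv hst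
  rw [← inv_mul_le_iff₀ hlam] at h3
  linarith

theorem dualGradient_eq_of_subgradient {Z₀ : StrongDual ℝ V → ℝ} {x : StrongDual ℝ V}
    (hd : DifferentiableAt ℝ Z₀ x) {v : V} (hv : ∀ y, Z₀ x + (y - x) v ≤ Z₀ y) :
    dualGradient Z₀ x = v := by
  have hmin : IsLocalMin (fun y => Z₀ y - y v) x := Eventually.of_forall fun y => by
    have := hv y
    simp only [_root_.sub_apply] at this ⊢
    linarith
  have hder : HasFDerivAt (fun y : StrongDual ℝ V => Z₀ y - y v)
      (fderiv ℝ Z₀ x - ContinuousLinearMap.apply ℝ ℝ v) x :=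
    hd.hasFDerivAt.sub (ContinuousLinearMap.apply ℝ ℝ v).hasFDerivAt
  have h0 := hmin.hasFDerivAt_eq_zero hder
  refine eq_of_forall_dual_eq fun y => ?_
  rw [apply_dualGradient, sub_eq_zero.1 h0, ContinuousLinearMap.apply_apply]

/-! ## Equilibria -/

theorem isMPEquilibrium_iff (hdata : StandingAssumptions S A g₀ h₀ p lam ω)
    {x : StrongDual ℝ V} {π : V} {u : U} :
    IsMPEquilibrium A B g₀ h₀ lam x π u ↔
      (∃ hx : x ∈ A.domain, A ⟨x, hx⟩ + B u = 0) ∧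
      π = primalAdjoint (S.laplace ω lam) (dualGradient g₀ x) ∧ u = feedback B h₀ π := by
  have hR := isResolventOperator_primalAdjoint hdata.generator hdata.hasGrowth hdata.discount
  refine and_congr_right fun _ => and_congr_left fun _ => ⟨?_, ?_⟩
  · rintro ⟨hπ, h⟩
    have := hR.2 ⟨π, hπ⟩
    rw [sub_eq_zero] at h
    rw [h] at this
    exact this.symm
  · rintro rfl
    obtain ⟨h, h'⟩ := hR.1 (dualGradient g₀ x)
    exact ⟨h, sub_eq_zero.2 h'⟩

theorem isOptimalControl_const (hdata : StandingAssumptions S A g₀ h₀ p lam ω) (hlam : 0 < lam)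
    {x₀ : A.domain} {π : V}
    (hπ : π = primalAdjoint (S.laplace ω lam) (dualGradient g₀ x₀))
    (hst : A x₀ + B (feedback B h₀ π) = 0) :
    IsOptimalControl S B g₀ h₀ p lam 0 x₀ (fun _ => feedback B h₀ π) := by
  refine ⟨isAdmissible_const (by linarith [hdata.coercive.1]) hlam _, fun w hw => ?_⟩
  rw [cost_const_stationary hdata.generator hdata.hasGrowth hlam hst]
  simpa using le_cost hdata hlam hπ hst x₀ hw

theorem costate_mem_dualSubdiff (hdata : StandingAssumptions S A g₀ h₀ p lam ω) (hlam : 0 < lam)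
    {x₀ : A.domain} {π : V}
    (hπ : π = primalAdjoint (S.laplace ω lam) (dualGradient g₀ x₀))
    (hst : A x₀ + B (feedback B h₀ π) = 0) :
    π ∈ dualSubdiff (valueZero S B g₀ h₀ p lam) x₀ := by
  have hp : 0 < p := by linarith [hdata.coercive.1]
  have hle : ∀ x : StrongDual ℝ V, ((lam⁻¹ * (g₀ x₀ + h₀ (feedback B h₀ π)) + (x - x₀) π : ℝ) : EReal) ≤
      valueZero S B g₀ h₀ p lam x := fun x =>
    le_iInf fun ⟨w, hw⟩ => le_cost hdata hlam hπ hst x hw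
  have hval : valueZero S B g₀ h₀ p lam x₀ =
      ((lam⁻¹ * (g₀ x₀ + h₀ (feedback B h₀ π)) : ℝ) : EReal) := by
    refine le_antisymm ?_ (by simpa using hle x₀)
    rw [← cost_const_stationary hdata.generator hdata.hasGrowth hlam hst]
    exact valueZero_le_cost (isAdmissible_const hp hlam _) _
  refine ⟨hval ▸ EReal.coe_ne_bot _, hval ▸ EReal.coe_ne_top _, fun y => ?_⟩
  rw [hval, ← EReal.coe_add]
  exact hle y

end Value

end

theorem mainTheorem3 {U V : Type*}
    [NormedAddCommGroup U] [InnerProductSpace ℝ U] [CompleteSpace U]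
    [TopologicalSpace.SeparableSpace U]
    [NormedAddCommGroup V] [InnerProductSpace ℝ V] [CompleteSpace V]
    [TopologicalSpace.SeparableSpace V]
    (S : C0Semigroup (StrongDual ℝ V)) (A : StrongDual ℝ V →ₗ.[ℝ] StrongDual ℝ V)
    (B : U →L[ℝ] StrongDual ℝ V) (g₀ : StrongDual ℝ V → ℝ) (h₀ : U → ℝ) (p lam ω : ℝ)
    (hdata : StandingAssumptions S A g₀ h₀ p lam ω)
    (hp : 2 ≤ p) (hlam : max (2 * ω) ω < lam) :
    InResolventSet (dualityAdjoint A) lam ∧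
    (∀ (x : StrongDual ℝ V) (π : V) (u : U), IsMPEquilibrium A B g₀ h₀ lam x π u →
      (∃ hx : x ∈ A.domain,
        A ⟨x, hx⟩ +
          B (feedback B h₀ (resolventOp (dualityAdjoint A) lam (dualGradient g₀ x))) = 0) ∧
      (0 < lam →
        IsOptimalControl S B g₀ h₀ p lam 0 x (fun _ => u) ∧
        IsCLEEquilibrium S A B g₀ h₀ p lam x ∧
        resolventOp (dualityAdjoint A) lam (dualGradient g₀ x) ∈
          dualSubdiff (valueZero S B g₀ h₀ p lam) x)) ∧
    (0 < lam → (2 < p ∨ (p = 2 ∧ ω < 0)) →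
      ∀ Z₀ : StrongDual ℝ V → ℝ,
        (∀ x : StrongDual ℝ V, valueZero S B g₀ h₀ p lam x = ((Z₀ x : ℝ) : EReal)) →
        Differentiable ℝ Z₀ →
        ∀ x : StrongDual ℝ V, IsCLEEquilibrium S A B g₀ h₀ p lam x →
        ∀ (π : V) (u : U), π = resolventOp (dualityAdjoint A) lam (dualGradient g₀ x) →
          u = feedback B h₀ π →
          IsMPEquilibrium A B g₀ h₀ lam x π u ∧
          IsOptimalControl S B g₀ h₀ p lam 0 x (fun _ => u) ∧
          dualGradient Z₀ x = π) := by
  have hres : resolventOp (dualityAdjoint A) lam = primalAdjoint (S.laplace ω lam) :=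
    resolventOp_dualityAdjoint hdata.generator hdata.hasGrowth hdata.discount
  refine ⟨⟨_, isResolventOperator_primalAdjoint hdata.generator hdata.hasGrowth hdata.discount⟩,
    ?_, ?_⟩
  · intro x π u hMP
    obtain ⟨⟨hx, hst⟩, hπ, rfl⟩ := (isMPEquilibrium_iff hdata).1 hMP
    rw [hres, ← hπ]
    refine ⟨⟨hx, hst⟩, fun hlam0 => ?_⟩
    have hmem := costate_mem_dualSubdiff (x₀ := ⟨x, hx⟩) hdata hlam0 hπ hst
    exact ⟨isOptimalControl_const (x₀ := ⟨x, hx⟩) hdata hlam0 hπ hst, ⟨hx, π, hmem, hst⟩, hmem⟩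
  · rintro hlam0 - Z₀ hZ hd x ⟨hx, v, ⟨-, -, hv⟩, hst⟩ π u hπ rfl
    rw [hres] at hπ
    have hv' : ∀ y, Z₀ x + (y - x) v ≤ Z₀ y := fun y => by
      have := hv y
      rwa [hZ, hZ, ← EReal.coe_add, EReal.coe_le_coe_iff] at this
    -- Once v is the costate, optimality follows as in the first part; differentiability of Z₀
    -- serves only to read v as its gradient.
    have hvπ : v = π := hπ ▸ subgradient_eq_costate (x₀ := ⟨x, hx⟩) hdata hlam0
      ((le_max_left _ _).trans_lt hlam) hZ hv' hst
    subst hvπ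
    exact ⟨(isMPEquilibrium_iff hdata).2 ⟨⟨hx, hst⟩, hπ, rfl⟩,
      isOptimalControl_const (x₀ := ⟨x, hx⟩) hdata hlam0 hπ hst,
      dualGradient_eq_of_subgradient (hd x) hv'⟩
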